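/- Let $N\ge 2$ be an integer, $p>1$, and let $V:\mathbb R^N\to\mathbb R$ be Lebesgue measurable. Let $A,g:\mathbb R^N\times\mathbb R\to\mathbb R$ be such that $A(\cdot,t)$ and $g(\cdot,t)$ are measurable for all $t$ and, for a.e. $x$, $A(x,\cdot)$ is $C^1$ and $g(x,\cdot)$ is continuous. Put $A_t=\partial A/\partial t$, $G(x,t)=\int_0^t g(x,s)\,ds$, $B_\varrho(x)=\{y:|y-x|<\varrho\}$, $B_\varrho=B_\varrho(0)$, and $p^*=Np/(N-p)$ if $p<N$, $p^*=+\infty$ if $p\ge N$. **Spaces.** For $r\in[1,\infty)$, $|u|_r$ and $|u|_\infty$ are the norms of $L^r(\mathbb R^N)$ and $L^\infty(\mathbb R^N)$. Moreover, $|u|_{V,r}=\big(\int_{\mathbb R^N}V|u|^r\,dx\big)^{1/r}$, and $L^r_V(\mathbb R^N)$ is the set of $u\in L^r(\mathbb R^N)$ with $\int V|u|^r\,dx<\infty$. Let $W^{1,p}_V(\mathbb R^N)=\{u\in W^{1,p}(\mathbb R^N):\int V|u|^p\,dx<\infty\}$ with norm $\|u\|_V=\big(\int|\nabla u|^p\,dx+\int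 V|u|^p\,dx\big)^{1/p}$, and $X=W^{1,p}_V(\mathbb R^N)\cap L^\infty(\mathbb R^N)$ with norm $\|u\|_X=\|u\|_V+|u|_\infty$. For $k\in\{1,2,\dots\}$ let $X_{B_k}$ be the set of $u\in W^{1,p}_0(B_k)\cap L^\infty(B_k)$ with $\int_{B_k} V|u|^p\,dx<\infty$; these functions are extended by $0$ to $\mathbb R^N$, so that $X_{B_k}\subset X$. **Assumptions.** There are constants $\alpha_0,\alpha_1,\alpha_2,a_1,a_2>0$, $\mu>p$, $q$ with $p\le q<p^*$, $\bar\alpha\in\mathbb R$, and $\tau_p>0$ with $|u|_p\le\tau_p\|u\|_V$ for all $u\in W_V^{1,p}(\mathbb R^N)$, such that, for a.e. $x\in\mathbb R^N$ and all $t\in\mathbb R$ where $x$ and $t$ occur freely: * $\operatorname{ess\,inf}V>0$; $\ \lim_{|x|\to\infty}\int_{B_1(x)}\frac{dy}{V(y)}=0$; $\ V$ is essentially bounded on every $B_\varrho$, $\varrho>0$; * $\sup_{|t|\le\rho}|A(\cdot,t)|$ and $\sup_{|t|\le\rho}|A_t(\cdot,t)|$ belong to $L^\infty(\mathbb R^N)$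 for every $\rho>0$; * $A(x,t)\ge\alpha_0$; $\ (\mu-p)A(x,t)-A_t(x,t)t\ge\alpha_1A(x,t)$; $\ pA(x,t)+A_t(x,t)t\ge\alpha_2A(x,t)$; * $|g(x,t)|\le a_1|t|^{p-1}+a_2|t|^{q-1}$; * $\lim_{t\to0}\frac{g(x,t)}{|t|^{p-2}t}=\bar\alpha<\frac{\alpha_0}{\tau_p^p}$ uniformly for a.e. $x$; * $0<\mu G(x,t)\le g(x,t)t$ if $t\neq0$. **Functional.** For $u,v\in X$ set $$\mathcal J(u)=\frac1p\int_{\mathbb R^N}A(x,u)|\nabla u|^p\,dx+\frac1p\int_{\mathbb R^N}V|u|^p\,dx-\int_{\mathbb R^N}G(x,u)\,dx,$$ $$\langle d\mathcal J(u),v\rangle=\int_{\mathbb R^N}A(x,u)|\nabla u|^{p-2}\nabla u\cdot\nabla v\,dx+\frac1p\int_{\mathbb R^N}A_t(x,u)v|\nabla u|^p\,dx+\int_{\mathbb R^N}V|u|^{p-2}uv\,dx-\int_{\mathbb R^N}g(x,u)v\,dx.$$ **Critical points.** Let $\varrho,\alpha^*>0$ be such that $\mathcal J(u)\ge\alpha^*$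 for all $u\in X$ with $\|u\|_V=\varrho$, let $u^*\in X$ have support contained in $B_1$ and satisfy $\|u^*\|_V>\varrho$ and $\mathcal J(u^*)<\alpha^*$, and let $\alpha^{**}=\max_{s\in[0,1]}\mathcal J(su^*)$. Let $(u_k)_{k\ge1}$ be any sequence such that, for every $k\ge1$, 1. $u_k\in X_{B_k}$, 2. $\alpha^*\le\mathcal J(u_k)\le\alpha^{**}$, 3. $\langle d\mathcal J(u_k),v\rangle=0$ for all $v\in X_{B_k}$. **Proposition.** Under these assumptions there is a constant $M_0>0$ such that $u_k\in X$ and $\|u_k\|_X\le M_0$ for all $k\ge1$. Moreover, with the same $M_0$, for every real $r\ge p$ and all $k\ge1$, $u_k\in L^r_V(\mathbb R^N)$ and $|u_k|_{V,r}\le M_0$. -/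

import Mathlib

open MeasureTheory Set Filter Topology
open scoped ENNReal ContDiff

noncomputable section

namespace QuasilinearSchrodinger

/-- The Euclidean space `ℝ^N`. -/
abbrev E (N : ℕ) : Type := EuclideanSpace ℝ (Fin N)

variable {N : ℕ}

/-! ### Weak gradients and Sobolev spaces

Elements of the spaces below are represented by functions `ℝ^N → ℝ`; all notions only depend on the
almost everywhere class. -/

/-- `w` is a weak gradient of `u` on `ℝ^N`: both are locally integrable and
`∫ u ∂ᵢφ = - ∫ wᵢ φ` for every `i` and every test function `φ ∈ C_c^∞(ℝ^N)`. -/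
def HasWeakGradient (u : E N → ℝ) (w : E N → E N) : Prop :=
  LocallyIntegrable u ∧ LocallyIntegrable w ∧
    ∀ φ : E N → ℝ, ContDiff ℝ ∞ φ → HasCompactSupport φ → ∀ i : Fin N,
      ∫ x, u x * fderiv ℝ φ x (EuclideanSpace.single i 1) = - ∫ x, w x i * φ x

open Classical in
/-- The weak gradient `∇u` (a representative of it; the weak gradient is unique up to null sets).
It is only ever used for functions that possess one. -/
def weakGrad (u : E N → ℝ) : E N → E N :=
  if h : ∃ w, HasWeakGradient u w then h.choose else 0

/-- `u ∈ W^{1,p}(ℝ^N)`. -/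
def MemW (p : ℝ) (u : E N → ℝ) : Prop :=
  MemLp u (ENNReal.ofReal p) volume ∧
    ∃ w : E N → E N, HasWeakGradient u w ∧ MemLp w (ENNReal.ofReal p) volume

/-- `u ∈ W_0^{1,p}(Ω)`, where a function on `Ω` is identified with its extension by `0` to `ℝ^N`:
`u` is a limit in `W^{1,p}` of smooth functions with compact support in `Ω`.
In particular `u = 0` almost everywhere outside `Ω`. -/
def MemWZero (p : ℝ) (Ω : Set (E N)) (u : E N → ℝ) : Prop :=
  MemW p u ∧ ∃ φ : ℕ → E N → ℝ,
    (∀ n, ContDiff ℝ ∞ (φ n) ∧ HasCompactSupport (φ n) ∧ tsupport (φ n) ⊆ Ω) ∧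
    Tendsto (fun n => eLpNorm (fun x => u x - φ n x) (ENNReal.ofReal p) volume) atTop (𝓝 0) ∧
    Tendsto (fun n => eLpNorm (fun x => weakGrad u x - gradient (φ n) x) (ENNReal.ofReal p) volume)
      atTop (𝓝 0)

/-- `u ∈ L_V^r(ℝ^N)`. -/
def MemLV (V : E N → ℝ) (r : ℝ) (u : E N → ℝ) : Prop :=
  MemLp u (ENNReal.ofReal r) volume ∧ Integrable (fun x => V x * |u x| ^ r) volume

/-- `|u|_{V,r} = (∫ V |u|^r)^{1/r}`. -/
def normLV (V : E N → ℝ) (r : ℝ) (u : E N → ℝ) : ℝ :=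
  (∫ x, V x * |u x| ^ r) ^ (1 / r)

/-- `u ∈ W_V^{1,p}(ℝ^N)`. -/
def MemWV (V : E N → ℝ) (p : ℝ) (u : E N → ℝ) : Prop :=
  MemW p u ∧ Integrable (fun x => V x * |u x| ^ p) volume

/-- `‖u‖_V = (∫ |∇u|^p + ∫ V |u|^p)^{1/p}`. -/
def normV (V : E N → ℝ) (p : ℝ) (u : E N → ℝ) : ℝ :=
  ((∫ x, ‖weakGrad u x‖ ^ p) + ∫ x, V x * |u x| ^ p) ^ (1 / p)

/-- `|u|_r`, the usual norm of `L^r(ℝ^N)`, for `1 ≤ r < ∞`. -/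
def normL (r : ℝ) (u : E N → ℝ) : ℝ := (∫ x, |u x| ^ r) ^ (1 / r)

/-- `|u|_∞`, the essential supremum of `|u|`. -/
def normLinf (u : E N → ℝ) : ℝ := (eLpNorm u ∞ volume).toReal

/-- `u ∈ X = W_V^{1,p}(ℝ^N) ∩ L^∞(ℝ^N)`. -/
def MemX (V : E N → ℝ) (p : ℝ) (u : E N → ℝ) : Prop :=
  MemWV V p u ∧ MemLp u ∞ volume

/-- `‖u‖_X = ‖u‖_V + |u|_∞`. -/
def normX (V : E N → ℝ) (p : ℝ) (u : E N → ℝ) : ℝ := normV V p u + normLinf u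

/-- `u ∈ X_Ω = W_{0,V}^{1,p}(Ω) ∩ L^∞(Ω)`, functions on `Ω` being extended by `0` to `ℝ^N`. -/
def MemXZero (V : E N → ℝ) (p : ℝ) (Ω : Set (E N)) (u : E N → ℝ) : Prop :=
  MemWZero p Ω u ∧ Integrable (fun x => V x * |u x| ^ p) volume ∧ MemLp u ∞ volume

/-! ### The functional -/

/-- The partial derivative `A_t(x,t) = ∂A/∂t (x,t)`. -/
def partialT (A : E N → ℝ → ℝ) (x : E N) (t : ℝ) : ℝ := deriv (A x) t

/-- `G(x,t) = ∫_0^t g(x,s) ds`. -/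
def primitive (g : E N → ℝ → ℝ) (x : E N) (t : ℝ) : ℝ := ∫ s in (0 : ℝ)..t, g x s

/-- `J(u) = (1/p) ∫ A(x,u)|∇u|^p + (1/p) ∫ V|u|^p - ∫ G(x,u)`. -/
def J (p : ℝ) (A : E N → ℝ → ℝ) (V : E N → ℝ) (g : E N → ℝ → ℝ) (u : E N → ℝ) : ℝ :=
  (1 / p) * (∫ x, A x (u x) * ‖weakGrad u x‖ ^ p)
    + (1 / p) * (∫ x, V x * |u x| ^ p)
    - ∫ x, primitive g x (u x)

/-- `⟨dJ(u), v⟩ = ∫ A(x,u)|∇u|^{p-2} ∇u·∇v + (1/p) ∫ A_t(x,u) v |∇u|^p + ∫ V|u|^{p-2} u v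
- ∫ g(x,u) v`. -/
def dJ (p : ℝ) (A : E N → ℝ → ℝ) (V : E N → ℝ) (g : E N → ℝ → ℝ) (u v : E N → ℝ) : ℝ :=
  (∫ x, A x (u x) * ‖weakGrad u x‖ ^ (p - 2) * inner ℝ (weakGrad u x) (weakGrad v x))
    + (1 / p) * (∫ x, partialT A x (u x) * v x * ‖weakGrad u x‖ ^ p)
    + (∫ x, V x * |u x| ^ (p - 2) * u x * v x)
    - ∫ x, g x (u x) * v x

/-! ### Assumptions on the data -/

/-- `h` is a `C^k`-Carathéodory function. -/
def IsCaratheodory (k : ℕ) (h : E N → ℝ → ℝ) : Prop :=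
  (∀ t : ℝ, AEMeasurable (fun x => h x t) volume) ∧ ∀ᵐ x : E N, ContDiff ℝ k (h x)

/-- The potential has positive essential infimum. -/
def HypV1 (V : E N → ℝ) : Prop := ∃ c > 0, ∀ᵐ x : E N, c ≤ V x

/-- `∫_{B_1(x)} 1/V → 0` as `|x| → ∞`. -/
def HypV2 (V : E N → ℝ) : Prop :=
  Tendsto (fun x : E N => ∫ y in Metric.ball x 1, 1 / V y) (cocompact (E N)) (𝓝 0)

/-- The potential is essentially bounded on bounded sets. -/
def HypV3 (V : E N → ℝ) : Prop :=
  ∀ ρ > 0, ∃ C > 0, ∀ᵐ x : E N, ‖x‖ ≤ ρ → V x ≤ C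

/-- `sup_{|t| ≤ ρ} |A(·,t)|` and `sup_{|t| ≤ ρ} |A_t(·,t)|` are in `L^∞` for each `ρ > 0`. -/
def HypH1 (A : E N → ℝ → ℝ) : Prop :=
  ∀ ρ > 0, ∃ C : ℝ, ∀ᵐ x : E N, ∀ t : ℝ, |t| ≤ ρ → |A x t| ≤ C ∧ |partialT A x t| ≤ C

/-- `A(x,t) ≥ α₀` with `α₀ > 0`. -/
def HypH2 (α₀ : ℝ) (A : E N → ℝ → ℝ) : Prop :=
  0 < α₀ ∧ ∀ᵐ x : E N, ∀ t : ℝ, α₀ ≤ A x t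

/-- `(μ - p) A(x,t) - A_t(x,t) t ≥ α₁ A(x,t)` with `μ > p`, for some `α₁ > 0`. -/
def HypH3 (p μ : ℝ) (A : E N → ℝ → ℝ) : Prop :=
  p < μ ∧ ∃ α₁ > 0, ∀ᵐ x : E N, ∀ t : ℝ, α₁ * A x t ≤ (μ - p) * A x t - partialT A x t * t

/-- `p A(x,t) + A_t(x,t) t ≥ α₂ A(x,t)` for some `α₂ > 0`. -/
def HypH4 (p : ℝ) (A : E N → ℝ → ℝ) : Prop :=
  ∃ α₂ > 0, ∀ᵐ x : E N, ∀ t : ℝ, α₂ * A x t ≤ p * A x t + partialT A x t * t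

/-- `|g(x,t)| ≤ a₁|t|^{p-1} + a₂|t|^{q-1}` with `q ≥ p`, for some `a₁, a₂ > 0`. -/
def HypG1 (p q : ℝ) (g : E N → ℝ → ℝ) : Prop :=
  p ≤ q ∧ ∃ a₁ > 0, ∃ a₂ > 0, ∀ᵐ x : E N, ∀ t : ℝ,
    |g x t| ≤ a₁ * |t| ^ (p - 1) + a₂ * |t| ^ (q - 1)

/-- `τ > 0` is a constant for the embedding `W_V^{1,p}(ℝ^N) ↪ L^p(ℝ^N)`. -/
def IsEmbeddingConst (V : E N → ℝ) (p τ : ℝ) : Prop :=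
  0 < τ ∧ ∀ u : E N → ℝ, MemWV V p u → normL p u ≤ τ * normV V p u

/-- `g(x,t)/(|t|^{p-2}t) → ᾱ` as `t → 0`, uniformly for a.e. `x`, for some real `ᾱ < α₀/τ^p`. -/
def HypG2 (p α₀ τ : ℝ) (g : E N → ℝ → ℝ) : Prop :=
  ∃ αbar : ℝ, αbar < α₀ / τ ^ p ∧ ∀ ε > 0, ∃ δ > 0, ∀ᵐ x : E N, ∀ t : ℝ, 0 < |t| → |t| < δ →
    |g x t / (|t| ^ (p - 2) * t) - αbar| < ε

/-- `0 < μ G(x,t) ≤ g(x,t) t` for `t ≠ 0`. -/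
def HypG3 (μ : ℝ) (g : E N → ℝ → ℝ) : Prop :=
  ∀ᵐ x : E N, ∀ t : ℝ, t ≠ 0 → 0 < μ * primitive g x t ∧ μ * primitive g x t ≤ g x t * t

/-- The critical Sobolev exponent `p^*`, equal to `Np/(N-p)` if `p < N` and `+∞` otherwise. -/
def criticalExponent (N : ℕ) (p : ℝ) : EReal :=
  if p < N then ((N * p / (N - p) : ℝ) : EReal) else ⊤

/-! ### Mountain pass geometry and the sequence of critical points -/

/-- `ϱ, α^* > 0` and `J(u) ≥ α^*` whenever `u ∈ X`, `‖u‖_V = ϱ`;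
moreover `u^* ∈ X` has support in `B_1`, `‖u^*‖_V > ϱ` and `J(u^*) < α^*`. -/
structure MountainPassGeometry (p : ℝ) (A : E N → ℝ → ℝ) (V : E N → ℝ) (g : E N → ℝ → ℝ)
    (ϱ αlow : ℝ) (ustar : E N → ℝ) : Prop where
  radius_pos : 0 < ϱ
  level_pos : 0 < αlow
  sphere : ∀ u : E N → ℝ, MemX V p u → normV V p u = ϱ → αlow ≤ J p A V g u
  mem : MemX V p ustar
  support : tsupport ustar ⊆ Metric.ball 0 1
  norm_gt : ϱ < normV V p ustar
  value_lt : J p A V g ustar < αlow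

/-- `(u_k)_{k ≥ 1}`: `u_k ∈ X_{B_k}` is a critical point of the restriction of `J` to `X_{B_k}`
with level between `αlow` and `αup`. The term of index `0` plays no role. -/
structure IsMountainPassSequence (p : ℝ) (A : E N → ℝ → ℝ) (V : E N → ℝ) (g : E N → ℝ → ℝ)
    (αlow αup : ℝ) (u : ℕ → E N → ℝ) : Prop where
  mem : ∀ k : ℕ, 1 ≤ k → MemXZero V p (Metric.ball 0 k) (u k)
  level_ge : ∀ k : ℕ, 1 ≤ k → αlow ≤ J p A V g (u k)
  level_le : ∀ k : ℕ, 1 ≤ k → J p A V g (u k) ≤ αup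
  critical : ∀ k : ℕ, 1 ≤ k → ∀ v : E N → ℝ, MemXZero V p (Metric.ball 0 k) v →
    dJ p A V g (u k) v = 0

end QuasilinearSchrodinger

end

/-!
Testing the equation of a critical point `u` on `Ω` with `u` itself, `(μ - p) A - A_t t ≥ α₁ A` and
`μ G ≤ g t` bound `∫ |∇u|^p`, `∫ V |u|^p` and `∫ |u|^p` by a multiple of `𝒥(u)`, independently of
`Ω`. Testing with `(u² + ε)^{s/2} u`, where `σ = p + s`, letting `ε → 0` and applying a Sobolev
embedding into some `L^m` with `m > q` yields, since `p A + A_t t ≥ α₂ A`, the estimate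
`|u|_{mσ/p}^σ ≤ D σ^p (|u|_σ^σ + |u|_{q-p+σ}^{q-p+σ})` with `D` independent of `Ω`. Interpolating
`|u|_{q-p+σ}` between `L^m`, where `u` is already controlled, and `L^ρ` with
`mσ = (m - (q - p)) ρ`, one passes from `L^ρ` to `L^{κρ}` with `κ = (m - (q - p)) / p > 1`. The
constants of the successive steps have a convergent product, so `u` is bounded in `L^∞`
independently of `Ω`; this bound and that of `∫ V |u|^p` control every `|u|_{V,r}`, `r ≥ p`.
-/

namespace QuasilinearSchrodinger

section LebesgueNorms

variable {α ε : Type*} [MeasurableSpace α] {μ : Measure α} [TopologicalSpace ε] [ContinuousENorm ε]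
  {f : α → ε}

lemma eLpNorm'_rpow_le_mul {a b θ₁ θ₂ : ℝ} (hf : AEStronglyMeasurable f μ) (ha : 0 < a)
    (hb : 0 < b) (hθ₁ : 0 ≤ θ₁) (hθ₂ : 0 ≤ θ₂) (hθ : θ₁ + θ₂ = 1) :
    eLpNorm' f (θ₁ * a + θ₂ * b) μ ^ (θ₁ * a + θ₂ * b) ≤
      eLpNorm' f a μ ^ (θ₁ * a) * eLpNorm' f b μ ^ (θ₂ * b) := by
  have hc : 0 < θ₁ * a + θ₂ * b := by
    rcases hθ₁.eq_or_lt with rfl | h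
    · simpa [show θ₂ = 1 by linarith] using hb
    · positivity
  rw [mul_comm θ₁ a, mul_comm θ₂ b] at *
  rw [ENNReal.rpow_mul, ENNReal.rpow_mul, ← lintegral_rpow_enorm_eq_rpow_eLpNorm' ha,
    ← lintegral_rpow_enorm_eq_rpow_eLpNorm' hb, ← lintegral_rpow_enorm_eq_rpow_eLpNorm' hc]
  calc ∫⁻ x, ‖f x‖ₑ ^ (a * θ₁ + b * θ₂) ∂μ
      = ∫⁻ x, (‖f x‖ₑ ^ a) ^ θ₁ * (‖f x‖ₑ ^ b) ^ θ₂ ∂μ := by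
        refine lintegral_congr fun x => ?_
        rw [ENNReal.rpow_add_of_nonneg _ _ (by positivity) (by positivity), ENNReal.rpow_mul,
          ENNReal.rpow_mul]
    _ ≤ _ := ENNReal.lintegral_mul_norm_pow_le (hf.enorm.pow_const _) (hf.enorm.pow_const _)
        hθ₁ hθ₂ hθ

lemma eLpNorm'_le_max {a b c : ℝ} (hf : AEStronglyMeasurable f μ) (ha : 0 < a) (hac : a ≤ c)
    (hcb : c ≤ b) : eLpNorm' f c μ ≤ max (eLpNorm' f a μ) (eLpNorm' f b μ) := by
  rcases (hac.trans hcb).eq_or_lt with rfl | hab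
  · simp [le_antisymm hcb hac]
  set M := max (eLpNorm' f a μ) (eLpNorm' f b μ)
  have hba : 0 < b - a := sub_pos.2 hab
  have hb : 0 < b := ha.trans hab
  set θ₁ := (b - c) / (b - a) with hθ₁_def
  set θ₂ := (c - a) / (b - a) with hθ₂_def
  have hθ₁ : 0 ≤ θ₁ := div_nonneg (sub_nonneg.2 hcb) hba.le
  have hθ₂ : 0 ≤ θ₂ := div_nonneg (sub_nonneg.2 hac) hba.le
  have hc : θ₁ * a + θ₂ * b = c := by rw [hθ₁_def, hθ₂_def]; field_simp; ring
  have hsum : θ₁ + θ₂ = 1 := by rw [hθ₁_def, hθ₂_def]; field_simp; ring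
  rw [← ENNReal.rpow_le_rpow_iff (ha.trans_le hac)]
  calc eLpNorm' f c μ ^ c ≤ eLpNorm' f a μ ^ (θ₁ * a) * eLpNorm' f b μ ^ (θ₂ * b) := by
        simpa only [hc] using eLpNorm'_rpow_le_mul hf ha hb hθ₁ hθ₂ hsum
    _ ≤ M ^ (θ₁ * a) * M ^ (θ₂ * b) := by
        gcongr
        exacts [le_max_left _ _, le_max_right _ _]
    _ = M ^ c := by rw [← ENNReal.rpow_add_of_nonneg _ _ (by positivity) (by positivity), hc]

lemma eLpNorm_top_le_of_tendsto {ρ : ℕ → ℝ} {B : ℝ≥0∞} (hf : AEStronglyMeasurable f μ)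
    (hρ : Tendsto ρ atTop atTop) (hB : ∀ n, eLpNorm' f (ρ n) μ ≤ B) : eLpNorm f ∞ μ ≤ B := by
  refine le_of_forall_gt fun t ht => ?_
  obtain ⟨b, hBb, hbt⟩ := exists_between ht
  refine lt_of_le_of_lt ?_ hbt
  have hb0 : b ≠ 0 := (pos_of_gt hBb).ne'
  have hlt : B / b < 1 := ENNReal.div_lt_of_lt_mul (by simpa using hBb)
  have hmeas : μ {x | b ≤ ‖f x‖ₑ} = 0 := by
    refine le_antisymm (ge_of_tendsto ((ENNReal.tendsto_rpow_atTop_of_base_lt_one hlt).comp hρ) ?_)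
      zero_le
    filter_upwards [hρ.eventually_gt_atTop 0] with n hn
    have hn0 : ENNReal.ofReal (ρ n) ≠ 0 := (ENNReal.ofReal_pos.2 hn).ne'
    calc μ {x | b ≤ ‖f x‖ₑ} ≤ b⁻¹ ^ ρ n * eLpNorm' f (ρ n) μ ^ ρ n := by
          simpa [eLpNorm_eq_eLpNorm' hn0, hn.le] using
            meas_ge_le_mul_pow_eLpNorm_enorm μ hn0 ENNReal.ofReal_ne_top hf hb0
              fun h => absurd h (hbt.trans_le le_top).ne
      _ ≤ b⁻¹ ^ ρ n * B ^ ρ n := by gcongr; exact hB n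
      _ = (B / b) ^ ρ n := by rw [← ENNReal.mul_rpow_of_nonneg _ _ hn.le, mul_comm, div_eq_mul_inv]
  rw [eLpNorm_exponent_top]
  refine eLpNormEssSup_le_of_ae_enorm_bound ?_
  filter_upwards [measure_eq_zero_iff_ae_notMem.1 hmeas] with x hx
  exact (not_le.1 hx).le

end LebesgueNorms

section MoserIteration

lemma le_exp_tsum_mul {a : ℕ → ℝ≥0∞} {c : ℕ → ℝ} (hc : Summable c) (hc0 : ∀ n, 0 ≤ c n)
    (ha : ∀ n, a (n + 1) ≤ ENNReal.ofReal (Real.exp (c n)) * a n) (n : ℕ) :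
    a n ≤ ENNReal.ofReal (Real.exp (∑' i, c i)) * a 0 := by
  have hpartial : a n ≤ ENNReal.ofReal (Real.exp (∑ i ∈ Finset.range n, c i)) * a 0 := by
    induction n with
    | zero => simp
    | succ n ih =>
      calc a (n + 1) ≤ ENNReal.ofReal (Real.exp (c n)) *
            (ENNReal.ofReal (Real.exp (∑ i ∈ Finset.range n, c i)) * a 0) :=
            (ha n).trans (by gcongr)
        _ = _ := by
            rw [Finset.sum_range_succ, add_comm, Real.exp_add,
              ENNReal.ofReal_mul (Real.exp_pos _).le, mul_assoc]
  exact hpartial.trans (by gcongr; exact hc.sum_le_tsum _ fun i _ => hc0 i)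

lemma summable_log_mul_rpow_div {K p κ : ℝ} (hK : 0 < K) (hp : 0 < p) (hκ : 1 < κ) :
    Summable fun n : ℕ => Real.log (K * (p * κ ^ (n + 1)) ^ p) / (p * κ ^ (n + 1)) := by
  have hκ0 : 0 < κ := one_pos.trans hκ
  have hr : ‖κ⁻¹‖ < 1 := by
    rw [norm_inv, Real.norm_of_nonneg hκ0.le]; exact inv_lt_one_of_one_lt₀ hκ
  have hgeom : Summable fun n : ℕ =>
      (Real.log K + p * Real.log p) / p * κ⁻¹ ^ n + Real.log κ * ((n : ℝ) ^ 1 * κ⁻¹ ^ n) :=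
    ((summable_geometric_of_norm_lt_one hr).mul_left _).add
      ((summable_pow_mul_geometric_of_norm_lt_one 1 hr).mul_left _)
  refine ((summable_nat_add_iff 1).2 hgeom).congr fun n => ?_
  rw [Real.log_mul hK.ne' (by positivity), Real.log_rpow (by positivity),
    Real.log_mul hp.ne' (by positivity), Real.log_pow]
  simp only [inv_pow]
  field_simp
  push_cast
  ring

variable {α ε : Type*} [MeasurableSpace α] {μ : Measure α} [TopologicalSpace ε] [ContinuousENorm ε]

-- `‖f‖_{q-p+σ}` is interpolated between `L^m` and `L^ρ`; the relation between `σ` and `ρ` is what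
-- makes the resulting power of the `L^ρ` norm equal to `σ`.
lemma eLpNorm'_rpow_add_le {f : α → ε} {p q m σ ρ : ℝ} {L a : ℝ≥0∞} (hf : AEStronglyMeasurable f μ)
    (hp : 0 < p) (hpq : p ≤ q) (hqm : q < m) (hpσ : p ≤ σ) (hσρ : m * σ = (m - (q - p)) * ρ)
    (hLp : eLpNorm' f p μ ≤ L) (hLm : eLpNorm' f m μ ≤ L) (hLa : L ≤ a)
    (ha : eLpNorm' f ρ μ ≤ a) :
    eLpNorm' f σ μ ^ σ + eLpNorm' f (q - p + σ) μ ^ (q - p + σ) ≤ (1 + L ^ (q - p)) * a ^ σ := by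
  have hm : 0 < m := by linarith
  have hσ : 0 < σ := hp.trans_le hpσ
  have hρ : 0 < ρ := pos_of_mul_pos_right (hσρ ▸ mul_pos hm hσ) (by linarith)
  have hσ_le : σ ≤ ρ := by nlinarith
  have hfirst : eLpNorm' f σ μ ^ σ ≤ a ^ σ := by
    gcongr
    exact (eLpNorm'_le_max hf hp hpσ hσ_le).trans (max_le (hLp.trans hLa) ha)
  have hexp₁ : (q - p) / m * m = q - p := by field_simp
  have hexp₂ : (m - (q - p)) / m * ρ = σ := by field_simp; linarith
  have hsecond : eLpNorm' f (q - p + σ) μ ^ (q - p + σ) ≤ L ^ (q - p) * a ^ σ := by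
    have h := eLpNorm'_rpow_le_mul hf hm hρ (div_nonneg (sub_nonneg.2 hpq) hm.le)
      (div_nonneg (show 0 ≤ m - (q - p) by linarith) hm.le) (by field_simp; ring)
    rw [hexp₁, hexp₂] at h
    refine h.trans ?_
    gcongr
  rw [add_mul, one_mul]
  exact add_le_add hfirst hsecond

lemma max_eLpNorm'_le_exp_mul {f : α → ε} {p q m σ ρ D Λ : ℝ} (hf : AEStronglyMeasurable f μ)
    (hp : 1 ≤ p) (hpq : p ≤ q) (hqm : q < m) (hD : 1 ≤ D) (hΛ : 0 ≤ Λ) (hpσ : p ≤ σ)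
    (hσρ : m * σ = (m - (q - p)) * ρ) (hLp : eLpNorm' f p μ ≤ ENNReal.ofReal Λ)
    (hLm : eLpNorm' f m μ ≤ ENNReal.ofReal Λ)
    (hmoser : eLpNorm' f (m / p * σ) μ ^ σ ≤ ENNReal.ofReal (D * σ ^ p) *
      (eLpNorm' f σ μ ^ σ + eLpNorm' f (q - p + σ) μ ^ (q - p + σ))) :
    max (ENNReal.ofReal Λ) (eLpNorm' f (m / p * σ) μ) ≤
      ENNReal.ofReal (Real.exp (Real.log (D * (1 + Λ ^ (q - p)) * σ ^ p) / σ)) *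
        max (ENNReal.ofReal Λ) (eLpNorm' f ρ μ) := by
  have hσ0 : 0 < σ := by linarith
  have hKσ : 1 ≤ D * (1 + Λ ^ (q - p)) * σ ^ p :=
    one_le_mul_of_one_le_of_one_le
      (one_le_mul_of_one_le_of_one_le hD (by simpa using Real.rpow_nonneg hΛ _))
      (Real.one_le_rpow (hp.trans hpσ) (by linarith))
  set L := ENNReal.ofReal Λ with hL
  set a := max L (eLpNorm' f ρ μ)
  refine max_le ((le_max_left _ _).trans (le_mul_of_one_le_left zero_le ?_)) ?_
  · simpa using div_nonneg (Real.log_nonneg hKσ) hσ0.le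
  rw [← ENNReal.rpow_le_rpow_iff hσ0]
  calc eLpNorm' f (m / p * σ) μ ^ σ
      ≤ ENNReal.ofReal (D * σ ^ p) * ((1 + L ^ (q - p)) * a ^ σ) := hmoser.trans <| by
        gcongr
        exact eLpNorm'_rpow_add_le hf (by linarith) hpq hqm hpσ hσρ hLp hLm (le_max_left _ _)
          (le_max_right _ _)
    _ = ENNReal.ofReal (D * (1 + Λ ^ (q - p)) * σ ^ p) * a ^ σ := by
        rw [hL, ENNReal.ofReal_rpow_of_nonneg hΛ (sub_nonneg.2 hpq), ← ENNReal.ofReal_one,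
          ← ENNReal.ofReal_add one_pos.le (Real.rpow_nonneg hΛ _), ← mul_assoc,
          ← ENNReal.ofReal_mul (by positivity)]
        ring_nf
    _ = (ENNReal.ofReal (Real.exp (Real.log (D * (1 + Λ ^ (q - p)) * σ ^ p) / σ)) * a) ^ σ := by
        rw [ENNReal.mul_rpow_of_nonneg _ _ hσ0.le, ENNReal.ofReal_rpow_of_nonneg
          (Real.exp_pos _).le hσ0.le, ← Real.exp_mul, div_mul_cancel₀ _ hσ0.ne',
          Real.exp_log (one_pos.trans_le hKσ)]

lemma exists_eLpNorm_top_le_of_moser {p q m D Λ : ℝ} (hp : 1 ≤ p) (hpq : p ≤ q) (hqm : q < m)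
    (hD : 1 ≤ D) (hΛ : 0 ≤ Λ) :
    ∃ B : ℝ, ∀ f : α → ε, AEStronglyMeasurable f μ →
      eLpNorm' f p μ ≤ ENNReal.ofReal Λ → eLpNorm' f m μ ≤ ENNReal.ofReal Λ →
      (∀ σ, p ≤ σ → eLpNorm' f (m / p * σ) μ ^ σ ≤ ENNReal.ofReal (D * σ ^ p) *
        (eLpNorm' f σ μ ^ σ + eLpNorm' f (q - p + σ) μ ^ (q - p + σ))) →
      eLpNorm f ∞ μ ≤ ENNReal.ofReal B := by
  have hp0 : 0 < p := by linarith
  set κ := (m - (q - p)) / p with hκ_def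
  have hκ : 1 < κ := by rw [hκ_def, lt_div_iff₀ hp0]; linarith
  set K := D * (1 + Λ ^ (q - p))
  have hK : 1 ≤ K := one_le_mul_of_one_le_of_one_le hD (by simpa using Real.rpow_nonneg hΛ _)
  set c : ℕ → ℝ := fun n => Real.log (K * (p * κ ^ (n + 1)) ^ p) / (p * κ ^ (n + 1)) with hc_def
  have hpσ (n : ℕ) : p ≤ p * κ ^ (n + 1) := le_mul_of_one_le_right hp0.le (one_le_pow₀ hκ.le)
  have hc0 (n : ℕ) : 0 ≤ c n :=
    div_nonneg (Real.log_nonneg (one_le_mul_of_one_le_of_one_le hK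
      (Real.one_le_rpow (hp.trans (hpσ n)) hp0.le))) (hp0.le.trans (hpσ n))
  have hcs : Summable c := summable_log_mul_rpow_div (one_pos.trans_le hK) hp0 hκ
  refine ⟨Real.exp (∑' i, c i) * Λ, fun f hf hLp hLm hmoser => ?_⟩
  set a : ℕ → ℝ≥0∞ := fun n => max (ENNReal.ofReal Λ) (eLpNorm' f (m * κ ^ n) μ) with ha_def
  have hstep (n : ℕ) : a (n + 1) ≤ ENNReal.ofReal (Real.exp (c n)) * a n := by
    have hσρ : m * (p * κ ^ (n + 1)) = (m - (q - p)) * (m * κ ^ n) := by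
      rw [pow_succ, hκ_def]; field_simp
    simpa only [ha_def, hc_def, show m * κ ^ (n + 1) = m / p * (p * κ ^ (n + 1)) by field_simp]
      using max_eLpNorm'_le_exp_mul hf hp hpq hqm hD hΛ (hpσ n) hσρ hLp hLm (hmoser _ (hpσ n))
  refine eLpNorm_top_le_of_tendsto hf ((tendsto_pow_atTop_atTop_of_one_lt hκ).const_mul_atTop
    (show 0 < m by linarith)) fun n => ?_
  calc eLpNorm' f (m * κ ^ n) μ ≤ a n := le_max_right _ _
    _ ≤ ENNReal.ofReal (Real.exp (∑' i, c i)) * a 0 := le_exp_tsum_mul hcs hc0 hstep n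
    _ = ENNReal.ofReal (Real.exp (∑' i, c i) * Λ) := by
        simp only [ha_def, pow_zero, mul_one, max_eq_left hLm]
        rw [ENNReal.ofReal_mul (Real.exp_pos _).le]

end MoserIteration

section SobolevInequality

open Module
open scoped NNReal

variable {X F : Type*} [NormedAddCommGroup X] [NormedSpace ℝ X] [MeasurableSpace X] [BorelSpace X]
  [FiniteDimensional ℝ X] {μ : Measure X} [μ.IsAddHaarMeasure]
  [NormedAddCommGroup F] [InnerProductSpace ℝ F] {u : X → F}

lemma eLpNorm'_rpow_le_mul_eLpNorm'_fderiv {χ γ : ℝ≥0} {p p' : ℝ}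
    (hχ : NNReal.HolderConjugate (finrank ℝ X) χ) (hγ : 1 < γ) (hpp' : p.HolderConjugate p')
    (hu : ContDiff ℝ 1 u) (hsupp : HasCompactSupport u) :
    eLpNorm' u (χ * γ) μ ^ (γ : ℝ) ≤ eLpNormLESNormFDerivOneConst μ χ * γ *
      (eLpNorm' u (p' * (γ - 1)) μ ^ (γ - 1 : ℝ) * eLpNorm' (fderiv ℝ u) p μ) := by
  have hγ₀ : (1 : ℝ) < γ := hγ
  have hgns : eLpNorm' u (χ * γ) μ ^ (γ : ℝ) ≤ eLpNormLESNormFDerivOneConst μ χ *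
      ∫⁻ x, ‖fderiv ℝ (fun y => ‖u y‖ ^ (γ : ℝ)) x‖ₑ ∂μ := by
    rw [← eLpNorm'_norm_rpow _ _ _ (one_pos.trans hγ₀), ← eLpNorm_one_eq_lintegral_enorm,
      ← eLpNorm_nnreal_eq_eLpNorm' hχ.symm.pos.ne']
    exact eLpNorm_le_eLpNorm_fderiv_one μ (hu.norm_rpow hγ₀)
      (hsupp.norm.comp_left (g := (· ^ (γ : ℝ))) (Real.zero_rpow (one_pos.trans hγ₀).ne')) hχ
  refine hgns.trans ?_
  rw [mul_assoc]
  gcongr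
  calc ∫⁻ x, ‖fderiv ℝ (fun y => ‖u y‖ ^ (γ : ℝ)) x‖ₑ ∂μ
      ≤ ∫⁻ x, γ * (‖u x‖ₑ ^ (γ - 1 : ℝ) * ‖fderiv ℝ u x‖ₑ) ∂μ := by
        refine lintegral_mono fun x => ?_
        rw [← mul_assoc]
        exact enorm_fderiv_norm_rpow_le (hu.differentiable one_ne_zero) hγ
    _ = γ * ∫⁻ x, ‖u x‖ₑ ^ (γ - 1 : ℝ) * ‖fderiv ℝ u x‖ₑ ∂μ :=
        lintegral_const_mul' _ _ ENNReal.coe_ne_top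
    _ ≤ γ * ((∫⁻ x, (‖u x‖ₑ ^ (γ - 1 : ℝ)) ^ p' ∂μ) ^ (1 / p') *
          (∫⁻ x, ‖fderiv ℝ u x‖ₑ ^ p ∂μ) ^ (1 / p)) := by
        gcongr
        exact ENNReal.lintegral_mul_le_Lp_mul_Lq μ hpp'.symm
          (hu.continuous.enorm.measurable.pow_const _).aemeasurable
          (hu.continuous_fderiv one_ne_zero).enorm.measurable.aemeasurable
    _ = γ * (eLpNorm' u (p' * (γ - 1)) μ ^ (γ - 1 : ℝ) * eLpNorm' (fderiv ℝ u) p μ) := by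
        have hp' : p' ≠ 0 := hpp'.symm.ne_zero
        have hγ1 : (γ : ℝ) - 1 ≠ 0 := (sub_pos.2 hγ₀).ne'
        simp only [eLpNorm', ← ENNReal.rpow_mul, mul_comm ((γ : ℝ) - 1) p']
        congr 4
        field_simp

lemma exists_eLpNorm'_le_mul_add_eLpNorm'_fderiv {χ : ℝ≥0} {γ p p' : ℝ}
    (hχ : NNReal.HolderConjugate (finrank ℝ X) χ) (hpp' : p.HolderConjugate p') (hpγ : p ≤ γ)
    (hγ : p' * (γ - 1) ≤ χ * γ) :
    ∃ C : ℝ≥0, ∀ u : X → F, ContDiff ℝ 1 u → HasCompactSupport u →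
      eLpNorm' u (χ * γ) μ ≤ C * (eLpNorm' u p μ + eLpNorm' (fderiv ℝ u) p μ) := by
  have hγ1 : 1 < γ := hpp'.lt.trans_le hpγ
  lift γ to ℝ≥0 using by linarith
  have hp : p ≤ p' * (γ - 1) := by
    nlinarith [hpp'.mul_eq_add, mul_le_mul_of_nonneg_left hpγ hpp'.symm.nonneg]
  have hr : 0 < χ * (γ : ℝ) := mul_pos hχ.coe.symm.pos (one_pos.trans hγ1)
  refine ⟨max 1 (eLpNormLESNormFDerivOneConst μ χ * γ), fun u hu hsupp => ?_⟩
  set C := eLpNormLESNormFDerivOneConst μ χ * γ with hC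
  rcases le_or_gt (eLpNorm' u (χ * γ) μ) (eLpNorm' u p μ) with hle | hlt
  · calc eLpNorm' u (χ * γ) μ ≤ 1 * eLpNorm' u p μ := by rwa [one_mul]
      _ ≤ _ := by gcongr; exacts [mod_cast le_max_left _ _, le_self_add]
  have hne_top : eLpNorm' u (χ * γ) μ ≠ ⊤ := by
    have h := (hu.continuous.memLp_of_hasCompactSupport (μ := μ) (p := ENNReal.ofReal (χ * γ))
      hsupp).eLpNorm_ne_top
    rwa [eLpNorm_eq_eLpNorm' (ENNReal.ofReal_pos.2 hr).ne' ENNReal.ofReal_ne_top,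
      ENNReal.toReal_ofReal hr.le] at h
  set a := eLpNorm' u (χ * γ) μ
  have hne_zero : a ≠ 0 := (zero_le.trans_lt hlt).ne'
  -- The norm of order `p' (γ - 1)` lies between those of orders `p` and `χ γ`, hence is at most
  -- `a`, and its power `γ - 1` is absorbed by the left-hand side.
  have hmid : eLpNorm' u (p' * (γ - 1)) μ ≤ a :=
    (eLpNorm'_le_max hu.continuous.aestronglyMeasurable hpp'.pos hp hγ).trans_eq
      (max_eq_right hlt.le)
  have hmul : a ^ (γ - 1 : ℝ) * a ≤ a ^ (γ - 1 : ℝ) * (C * eLpNorm' (fderiv ℝ u) p μ) :=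
    calc a ^ (γ - 1 : ℝ) * a = a ^ (γ : ℝ) := by
          simpa using (ENNReal.rpow_add ((γ : ℝ) - 1) 1 hne_zero hne_top).symm
      _ ≤ C * (a ^ (γ - 1 : ℝ) * eLpNorm' (fderiv ℝ u) p μ) := by
          refine (eLpNorm'_rpow_le_mul_eLpNorm'_fderiv hχ hγ1 hpp' hu hsupp).trans ?_
          rw [hC, ENNReal.coe_mul]
          gcongr
      _ = a ^ (γ - 1 : ℝ) * (C * eLpNorm' (fderiv ℝ u) p μ) := mul_left_comm _ _ _
  calc a ≤ C * eLpNorm' (fderiv ℝ u) p μ :=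
        (ENNReal.mul_le_mul_iff_right (ENNReal.rpow_pos (pos_iff_ne_zero.2 hne_zero) hne_top).ne'
          (ENNReal.rpow_ne_top_of_nonneg (sub_pos.2 hγ1).le hne_top)).1 hmul
    _ ≤ _ := by gcongr; exacts [mod_cast le_max_right _ _, le_add_self]

-- For `p < N` the exponent `χ γ` is the critical one; for `p ≥ N` any large `γ` is admissible.
lemma exists_gagliardo_exponent {N : ℕ} {χ : ℝ≥0} {p p' q : ℝ}
    (hχ : NNReal.HolderConjugate N χ) (hpp' : p.HolderConjugate p')
    (hq : (q : EReal) < criticalExponent N p) :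
    ∃ γ : ℝ, p ≤ γ ∧ p' * (γ - 1) ≤ χ * γ ∧ q < χ * γ := by
  have hp1 : 0 < p - 1 := sub_pos.2 hpp'.lt
  have hχ' : (χ : ℝ) = N / (N - 1) := by simpa using hχ.coe.conjugate_eq
  have hN : (1 : ℝ) < N := by simpa using hχ.coe.lt
  have hN1 : (0 : ℝ) < N - 1 := sub_pos.2 hN
  rcases lt_or_ge p N with hpN | hNp
  · have hNp : 0 < (N : ℝ) - p := sub_pos.2 hpN
    have hq' : q < N * p / (N - p) := by simpa [criticalExponent, hpN] using hq
    have hr : N * p / (N - p) = χ * (p * (N - 1) / (N - p)) := by rw [hχ']; field_simp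
    refine ⟨p * (N - 1) / (N - p), ?_, ?_, hr ▸ hq'⟩
    · rw [le_div_iff₀ hNp]
      nlinarith [hpp'.pos]
    · rw [← hr, hpp'.conjugate_eq]
      apply le_of_eq
      field_simp
      ring
  · have hp'χ : p' ≤ χ := by
      rw [hχ', hpp'.conjugate_eq, div_le_div_iff₀ hp1 hN1]
      linarith
    refine ⟨max p (q + 1), le_max_left _ _, ?_, ?_⟩
    · nlinarith [hpp'.symm.pos, hpp'.pos, le_max_left p (q + 1)]
    · nlinarith [hχ.coe.symm.lt, hpp'.pos, le_max_left p (q + 1), le_max_right p (q + 1)]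

end SobolevInequality

section LpLimits

variable {α : Type*} [MeasurableSpace α] {μ : Measure α} {P Q : ℝ≥0∞}

lemma tendsto_integral_mul_of_tendsto_eLpNorm_sub [ENNReal.HolderConjugate P Q] {f ψ : α → ℝ}
    {F : ℕ → α → ℝ} (hf : MemLp f P μ) (hF : ∀ n, MemLp (F n) P μ) (hψ : MemLp ψ Q μ)
    (h : Tendsto (fun n => eLpNorm (fun x => f x - F n x) P μ) atTop (𝓝 0)) :
    Tendsto (fun n => ∫ x, F n x * ψ x ∂μ) atTop (𝓝 (∫ x, f x * ψ x ∂μ)) := by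
  have hQP : ENNReal.HolderConjugate Q P := ENNReal.HolderTriple.symm
  refine tendsto_integral_of_L1' _ (hf.1.mul hψ.1)
    (Eventually.of_forall fun n => (hF n).integrable_mul hψ) ?_
  have hlim := ENNReal.Tendsto.const_mul h (Or.inr hψ.2.ne)
  rw [mul_zero] at hlim
  refine tendsto_of_tendsto_of_tendsto_of_le_of_le tendsto_const_nhds hlim
    (fun _ => zero_le) fun n => ?_
  refine le_trans (le_of_eq ?_)
    (eLpNorm_smul_le_mul_eLpNorm (p := Q) (q := P) (r := 1) (hf.1.sub (hF n).1) hψ.1)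
  rw [eLpNorm_sub_comm]
  congr 1
  ext x
  simp only [Pi.sub_apply, Pi.mul_apply, Pi.smul_apply', smul_eq_mul]
  ring

lemma ae_abs_le_eLpNorm_top {f : α → ℝ} (hf : MemLp f ⊤ μ) :
    ∀ᵐ x ∂μ, |f x| ≤ (eLpNorm f ⊤ μ).toReal := by
  filter_upwards [enorm_ae_le_eLpNormEssSup f μ] with x hx
  simpa [eLpNorm_exponent_top] using ENNReal.toReal_mono
    (by simpa only [eLpNorm_exponent_top] using hf.2.ne) hx

variable {G : Type*} [NormedAddCommGroup G]

lemma eLpNorm_le_add_eLpNorm_sub {f g : α → G} (hP : 1 ≤ P) (hf : AEStronglyMeasurable f μ)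
    (hg : AEStronglyMeasurable g μ) :
    eLpNorm g P μ ≤ eLpNorm f P μ + eLpNorm (fun x => f x - g x) P μ := by
  calc eLpNorm g P μ = eLpNorm (f - (f - g)) P μ := by rw [sub_sub_cancel]
    _ ≤ _ := eLpNorm_sub_le hf (hf.sub hg) hP

variable [NormedSpace ℝ G]

lemma tendsto_eLpNorm_smul_of_tendsto_ae (hP : P ≠ ⊤) {w : α → G} (hw : MemLp w P μ)
    {f : ℕ → α → ℝ} (hf : ∀ n, AEStronglyMeasurable (f n) μ) {C : ℝ} (hC : ∀ n x, |f n x| ≤ C)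
    (hlim : ∀ᵐ x ∂μ, Tendsto (fun n => f n x) atTop (𝓝 0)) :
    Tendsto (fun n => eLpNorm (fun x => f n x • w x) P μ) atTop (𝓝 0) := by
  rcases eq_or_ne P 0 with rfl | hP₀
  · simp
  have hr : 0 < P.toReal := ENNReal.toReal_pos hP₀ hP
  have hrpow {s : ℝ} (hs : 0 < s) : Tendsto (fun y : ℝ≥0∞ => y ^ s) (𝓝 0) (𝓝 0) := by
    simpa only [ENNReal.zero_rpow_of_pos hs] using
      (ENNReal.continuous_rpow_const (y := s)).tendsto 0
  simp only [eLpNorm_eq_lintegral_rpow_enorm_toReal hP₀ hP]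
  refine (hrpow (one_div_pos.2 hr)).comp ?_
  rw [← lintegral_zero (μ := μ)]
  refine tendsto_lintegral_of_dominated_convergence'
    (fun x => ‖C • w x‖ₑ ^ P.toReal) (fun n => ((hf n).smul hw.1).enorm.pow_const _)
    (fun n => Eventually.of_forall fun x => ?_)
    (lintegral_rpow_enorm_lt_top_of_eLpNorm_lt_top hP₀ hP (hw.const_smul C).2).ne ?_
  · simp only [enorm_smul]
    gcongr
    exact enorm_le_iff_norm_le.2 ((hC n x).trans (le_abs_self C))
  · filter_upwards [hlim] with x hx
    exact (hrpow hr).comp (by simpa using (hx.smul_const (w x)).enorm)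

end LpLimits

section SobolevSpaces

variable {N : ℕ} {p : ℝ} {Ω : Set (E N)} {V u v : E N → ℝ} {w w' : E N → E N}

lemma locallyIntegrable_coord (hw : LocallyIntegrable w) (i : Fin N) :
    LocallyIntegrable (fun x => w x i) := fun x =>
  let ⟨s, hs, h⟩ := hw x
  ⟨s, hs, (EuclideanSpace.proj (𝕜 := ℝ) i).integrable_comp h⟩

lemma HasWeakGradient.ae_eq (h : HasWeakGradient u w) (h' : HasWeakGradient u w') :
    w =ᵐ[volume] w' := by
  have hcoord (i : Fin N) : ∀ᵐ x : E N, w x i = w' x i := by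
    refine ae_eq_of_integral_contDiff_smul_eq (locallyIntegrable_coord h.2.1 i)
      (locallyIntegrable_coord h'.2.1 i) fun φ hφ hc => ?_
    simpa only [h.2.2 φ hφ hc i, neg_inj, smul_eq_mul, mul_comm] using h'.2.2 φ hφ hc i
  filter_upwards [ae_all_iff.2 hcoord] with x hx
  exact PiLp.ext hx

lemma HasWeakGradient.weakGrad_ae_eq (h : HasWeakGradient u w) : weakGrad u =ᵐ[volume] w := by
  have hex : ∃ w, HasWeakGradient u w := ⟨w, h⟩
  rw [weakGrad, dif_pos hex]
  exact hex.choose_spec.ae_eq h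

lemma HasWeakGradient.congr (h : HasWeakGradient u w) (huv : u =ᵐ[volume] v) :
    HasWeakGradient v w := by
  refine ⟨fun x => ?_, h.2.1, fun φ hφ hc i => ?_⟩
  · obtain ⟨s, hs, hint⟩ := h.1 x
    exact ⟨s, hs, hint.congr (ae_restrict_of_ae huv)⟩
  · rw [← h.2.2 φ hφ hc i]
    refine integral_congr_ae ?_
    filter_upwards [huv] with x hx
    rw [hx]

lemma weakGrad_congr (huv : u =ᵐ[volume] v) : weakGrad u = weakGrad v := by
  have h : HasWeakGradient u = HasWeakGradient v :=
    funext fun w => propext ⟨fun h => h.congr huv, fun h => h.congr huv.symm⟩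
  rw [weakGrad, weakGrad, h]

lemma MemW.memLp_weakGrad (h : MemW p u) : MemLp (weakGrad u) (ENNReal.ofReal p) volume :=
  let ⟨_, hw, hm⟩ := h.2
  hm.ae_eq hw.weakGrad_ae_eq.symm

lemma MemWZero.congr (h : MemWZero p Ω u) (huv : u =ᵐ[volume] v) : MemWZero p Ω v := by
  obtain ⟨⟨hu, w, hw, hwp⟩, φ, hφ, hφu, hφw⟩ := h
  refine ⟨⟨hu.ae_eq huv, w, hw.congr huv, hwp⟩, φ, hφ, hφu.congr fun n => ?_, ?_⟩
  · exact eLpNorm_congr_ae (huv.sub .rfl)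
  · rwa [← weakGrad_congr huv]

lemma gradient_apply (φ : E N → ℝ) (x : E N) (i : Fin N) :
    gradient φ x i = fderiv ℝ φ x (EuclideanSpace.single i 1) := by
  rw [gradient, ← InnerProductSpace.toDual_symm_apply, EuclideanSpace.inner_single_right]
  simp

lemma norm_gradient (φ : E N → ℝ) (x : E N) : ‖gradient φ x‖ = ‖fderiv ℝ φ x‖ := by
  rw [gradient, LinearIsometryEquiv.norm_map]

lemma continuous_gradient {φ : E N → ℝ} (hφ : ContDiff ℝ 1 φ) : Continuous (gradient φ) :=
  (InnerProductSpace.toDual ℝ (E N)).symm.continuous.comp (hφ.continuous_fderiv one_ne_zero)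

lemma memLp_gradient {φ : E N → ℝ} (hφ : ContDiff ℝ 1 φ) (hc : HasCompactSupport φ) (P : ℝ≥0∞) :
    MemLp (gradient φ) P volume :=
  (continuous_gradient hφ).memLp_of_hasCompactSupport
    ((hc.fderiv ℝ).comp_left (g := (InnerProductSpace.toDual ℝ (E N)).symm) (map_zero _))

lemma gradient_comp {F : ℝ → ℝ} {φ : E N → ℝ} {x : E N} (hF : DifferentiableAt ℝ F (φ x))
    (hφ : DifferentiableAt ℝ φ x) :
    gradient (fun y => F (φ y)) x = deriv F (φ x) • gradient φ x := by
  rw [gradient, gradient, ← map_smul]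
  congr 1
  exact (hF.hasDerivAt.comp_hasFDerivAt x hφ.hasFDerivAt).fderiv

lemma hasWeakGradient_gradient {φ : E N → ℝ} (hφ : ContDiff ℝ 1 φ) (hc : HasCompactSupport φ) :
    HasWeakGradient φ (gradient φ) := by
  refine ⟨hφ.continuous.locallyIntegrable, (continuous_gradient hφ).locallyIntegrable,
    fun ψ hψ hψc i => ?_⟩
  have hdφ : Continuous fun x => fderiv ℝ φ x (EuclideanSpace.single i 1) :=
    (hφ.continuous_fderiv one_ne_zero).clm_apply continuous_const
  have hdψ : Continuous fun x => fderiv ℝ ψ x (EuclideanSpace.single i 1) :=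
    (hψ.continuous_fderiv (by simp)).clm_apply continuous_const
  simp only [gradient_apply]
  exact integral_mul_fderiv_eq_neg_fderiv_mul_of_integrable
    ((hdφ.mul hψ.continuous).integrable_of_hasCompactSupport hψc.mul_left)
    ((hφ.continuous.mul hdψ).integrable_of_hasCompactSupport hc.mul_right)
    ((hφ.continuous.mul hψ.continuous).integrable_of_hasCompactSupport hc.mul_right)
    (fun x _ => hφ.differentiable one_ne_zero x) (fun x _ => hψ.differentiable (by simp) x)

lemma hasWeakGradient_of_tendsto {P : ℝ≥0∞} (hP : 1 ≤ P) {φ : ℕ → E N → ℝ} {g : ℕ → E N → E N}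
    (hu : MemLp u P) (hw : MemLp w P) (hφ : ∀ n, MemLp (φ n) P) (hg : ∀ n, MemLp (g n) P)
    (h : ∀ n, HasWeakGradient (φ n) (g n))
    (hφu : Tendsto (fun n => eLpNorm (fun x => u x - φ n x) P) atTop (𝓝 0))
    (hgw : Tendsto (fun n => eLpNorm (fun x => w x - g n x) P) atTop (𝓝 0)) :
    HasWeakGradient u w := by
  have hPQ : ENNReal.HolderConjugate P (ENNReal.conjExponent P) := .conjExponent hP
  refine ⟨hu.locallyIntegrable hP, hw.locallyIntegrable hP, fun ψ hψ hψc i => ?_⟩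
  have hdψ : MemLp (fun x => fderiv ℝ ψ x (EuclideanSpace.single i 1)) (ENNReal.conjExponent P) :=
    ((hψ.continuous_fderiv (by simp)).clm_apply continuous_const).memLp_of_hasCompactSupport
      (hψc.fderiv_apply ℝ _)
  have hψm : MemLp ψ (ENNReal.conjExponent P) := hψ.continuous.memLp_of_hasCompactSupport hψc
  have hcoord {f : E N → E N} (hf : MemLp f P) : MemLp (fun x => f x i) P :=
    (EuclideanSpace.proj (𝕜 := ℝ) i).comp_memLp' hf
  have hgwi : Tendsto (fun n => eLpNorm (fun x => w x i - g n x i) P) atTop (𝓝 0) :=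
    tendsto_of_tendsto_of_tendsto_of_le_of_le tendsto_const_nhds hgw (fun _ => zero_le)
      fun n => eLpNorm_mono fun x => PiLp.norm_apply_le (w x - g n x) i
  have hlim := (tendsto_integral_mul_of_tendsto_eLpNorm_sub (hcoord hw) (fun n => hcoord (hg n))
    hψm hgwi).neg
  exact tendsto_nhds_unique (tendsto_integral_mul_of_tendsto_eLpNorm_sub hu hφ hdψ hφu)
    (hlim.congr fun n => ((h n).2.2 ψ hψ hψc i).symm)

lemma MemWZero.exists_tendsto_ae (hp : 0 < p) (hu : MemWZero p Ω u) : ∃ φ : ℕ → E N → ℝ,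
    (∀ n, ContDiff ℝ ∞ (φ n) ∧ HasCompactSupport (φ n) ∧ tsupport (φ n) ⊆ Ω) ∧
    Tendsto (fun n => eLpNorm (fun x => u x - φ n x) (ENNReal.ofReal p) volume) atTop (𝓝 0) ∧
    Tendsto (fun n => eLpNorm (fun x => weakGrad u x - gradient (φ n) x) (ENNReal.ofReal p) volume)
      atTop (𝓝 0) ∧
    ∀ᵐ x, Tendsto (fun n => φ n x) atTop (𝓝 (u x)) := by
  obtain ⟨hW, φ, hφ, hφu, hφw⟩ := hu
  have hmeas : TendstoInMeasure volume φ atTop u :=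
    tendstoInMeasure_of_tendsto_eLpNorm (ENNReal.ofReal_pos.2 hp).ne'
      (fun n => (hφ n).1.continuous.aestronglyMeasurable) hW.1.1
      (hφu.congr fun n => eLpNorm_sub_comm u (φ n) _ _)
  obtain ⟨ns, hns, hae⟩ := hmeas.exists_seq_tendsto_ae
  exact ⟨φ ∘ ns, fun n => hφ _, hφu.comp hns.tendsto_atTop, hφw.comp hns.tendsto_atTop, hae⟩

section ChainRule

open scoped NNReal

variable {F : ℝ → ℝ} {K : ℝ≥0} {φ : ℕ → E N → ℝ}

lemma tendsto_eLpNorm_gradient_comp (hp : 1 ≤ p) (hu : MemW p u) (hF : ContDiff ℝ 1 F)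
    (hK : LipschitzWith K F) (hφ : ∀ n, ContDiff ℝ 1 (φ n))
    (hφw : Tendsto (fun n => eLpNorm (fun x => weakGrad u x - gradient (φ n) x) (ENNReal.ofReal p)
      volume) atTop (𝓝 0))
    (hφu : ∀ᵐ x, Tendsto (fun n => φ n x) atTop (𝓝 (u x))) :
    Tendsto (fun n => eLpNorm (fun x => deriv F (u x) • weakGrad u x
      - gradient (fun y => F (φ n y)) x) (ENNReal.ofReal p) volume) atTop (𝓝 0) := by
  have hF' : Continuous (deriv F) := hF.continuous_deriv le_rfl
  have hbound (t : ℝ) : |deriv F t| ≤ K := norm_deriv_le_of_lipschitz hK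
  have hmeas (n : ℕ) : AEStronglyMeasurable (fun x => deriv F (φ n x)) volume :=
    (hF'.comp (hφ n).continuous).aestronglyMeasurable
  have hmeas' (n : ℕ) : AEStronglyMeasurable (fun x => deriv F (u x) - deriv F (φ n x)) volume :=
    (hF'.comp_aestronglyMeasurable hu.1.1).sub (hmeas n)
  have hfst := tendsto_eLpNorm_smul_of_tendsto_ae ENNReal.ofReal_ne_top hu.memLp_weakGrad
    hmeas' (C := K + K) (fun n x => (abs_sub _ _).trans (add_le_add (hbound _) (hbound _))) (by
      filter_upwards [hφu] with x hx
      simpa using tendsto_const_nhds (x := deriv F (u x)) |>.sub ((hF'.tendsto _).comp hx))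
  have hsnd := ENNReal.Tendsto.const_mul (a := ENNReal.ofReal K) hφw (Or.inr (by finiteness))
  have hsum := hfst.add hsnd
  rw [mul_zero, add_zero] at hsum
  refine tendsto_of_tendsto_of_tendsto_of_le_of_le tendsto_const_nhds hsum
    (fun _ => zero_le) fun n => ?_
  have hsplit : (fun x => deriv F (u x) • weakGrad u x - gradient (fun y => F (φ n y)) x)
      = (fun x => (deriv F (u x) - deriv F (φ n x)) • weakGrad u x)
        + fun x => deriv F (φ n x) • (weakGrad u x - gradient (φ n) x) := by
    ext1 x
    rw [gradient_comp (hF.differentiable one_ne_zero _) ((hφ n).differentiable one_ne_zero _),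
      Pi.add_apply]
    module
  rw [hsplit]
  refine (eLpNorm_add_le ((hmeas' n).smul hu.memLp_weakGrad.1) ((hmeas n).smul
    (hu.memLp_weakGrad.1.sub (continuous_gradient (hφ n)).aestronglyMeasurable))
    (ENNReal.one_le_ofReal.2 hp)).trans (add_le_add le_rfl ?_)
  refine eLpNorm_le_mul_eLpNorm_of_ae_le_mul (Eventually.of_forall fun x => ?_) _
  rw [Pi.smul_apply', norm_smul]
  exact mul_le_mul_of_nonneg_right (hbound _) (norm_nonneg _)

lemma MemW.memLp_deriv_smul_weakGrad (hu : MemW p u) (hF : ContDiff ℝ 1 F)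
    (hK : LipschitzWith K F) :
    MemLp (fun x => deriv F (u x) • weakGrad u x) (ENNReal.ofReal p) :=
  hu.memLp_weakGrad.of_le_mul (c := K)
    (((hF.continuous_deriv le_rfl).comp_aestronglyMeasurable hu.1.1).smul hu.memLp_weakGrad.1)
    (Eventually.of_forall fun x => by
      rw [norm_smul]
      exact mul_le_mul_of_nonneg_right (norm_deriv_le_of_lipschitz hK) (norm_nonneg _))

lemma MemWZero.comp_lipschitz (hp : 1 ≤ p) (hu : MemWZero p Ω u) (hF : ContDiff ℝ ∞ F)
    (hF₀ : F 0 = 0) (hK : LipschitzWith K F) :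
    MemWZero p Ω (fun x => F (u x)) ∧
      weakGrad (fun x => F (u x)) =ᵐ[volume] fun x => deriv F (u x) • weakGrad u x := by
  have hF₁ : ContDiff ℝ 1 F := hF.of_le (by exact_mod_cast le_top)
  obtain ⟨φ, hφ, hφu, hφw, hφae⟩ := hu.exists_tendsto_ae (one_pos.trans_le hp)
  have hφ₁ (n : ℕ) : ContDiff ℝ 1 (φ n) := (hφ n).1.of_le (by exact_mod_cast le_top)
  have hFφ (n : ℕ) : ContDiff ℝ 1 fun x => F (φ n x) := hF₁.comp (hφ₁ n)
  have hc (n : ℕ) : HasCompactSupport fun x => F (φ n x) := (hφ n).2.1.comp_left hF₀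
  have hlim : Tendsto (fun n => eLpNorm (fun x => F (u x) - F (φ n x)) (ENNReal.ofReal p) volume)
      atTop (𝓝 0) := by
    have hmul := ENNReal.Tendsto.const_mul (a := ENNReal.ofReal K) hφu (Or.inr (by finiteness))
    rw [mul_zero] at hmul
    exact tendsto_of_tendsto_of_tendsto_of_le_of_le tendsto_const_nhds hmul (fun _ => zero_le)
      fun n => eLpNorm_le_mul_eLpNorm_of_ae_le_mul
        (Eventually.of_forall fun x => hK.norm_sub_le _ _) _
  have hlim' := tendsto_eLpNorm_gradient_comp hp hu.1 hF₁ hK hφ₁ hφw hφae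
  have hmem : MemLp (fun x => F (u x)) (ENNReal.ofReal p) := hK.comp_memLp hF₀ hu.1.1
  have hmem' := hu.1.memLp_deriv_smul_weakGrad hF₁ hK
  have hgrad : HasWeakGradient (fun x => F (u x)) (fun x => deriv F (u x) • weakGrad u x) :=
    hasWeakGradient_of_tendsto (ENNReal.one_le_ofReal.2 hp) hmem hmem'
      (fun n => (hFφ n).continuous.memLp_of_hasCompactSupport (hc n))
      (fun n => memLp_gradient (hFφ n) (hc n) _)
      (fun n => hasWeakGradient_gradient (hFφ n) (hc n)) hlim hlim'
  exact ⟨⟨⟨hmem, _, hgrad, hmem'⟩, fun n x => F (φ n x), fun n => ⟨hF.comp (hφ n).1, hc n,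
    (tsupport_comp_subset hF₀ _).trans (hφ n).2.2⟩, hlim, hlim'.congr fun n =>
      eLpNorm_congr_ae (hgrad.weakGrad_ae_eq.symm.sub .rfl)⟩, hgrad.weakGrad_ae_eq⟩

lemma exists_lipschitzWith_eventuallyEq (hF : ContDiff ℝ ∞ F) {R : ℝ} (hR : 0 < R) :
    ∃ (H : ℝ → ℝ) (K : ℝ≥0), ContDiff ℝ ∞ H ∧ LipschitzWith K H ∧
      ∀ t, |t| < R → H =ᶠ[𝓝 t] F := by
  let η : ContDiffBump (0 : ℝ) := ⟨R, R + 1, hR, lt_add_one R⟩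
  have hηF : ContDiff ℝ ∞ fun t => η t * F t := η.contDiff.mul hF
  obtain ⟨K, hK⟩ := hηF.lipschitzWith_of_hasCompactSupport η.hasCompactSupport.mul_right
    (by simp)
  refine ⟨_, K, hηF, hK, fun t ht => ?_⟩
  filter_upwards [η.eventuallyEq_one_of_mem_ball (x := t) (by simpa [η] using ht)] with s hs
  rw [hs, Pi.one_apply, one_mul]

lemma MemXZero.comp (hp : 1 ≤ p) (hV : AEMeasurable V volume) (hu : MemXZero V p Ω u)
    (hF : ContDiff ℝ ∞ F) (hF₀ : F 0 = 0) :
    MemXZero V p Ω (fun x => F (u x)) ∧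
      weakGrad (fun x => F (u x)) =ᵐ[volume] fun x => deriv F (u x) • weakGrad u x := by
  obtain ⟨hW, hVu, hbdd⟩ := hu
  -- Since `u` is bounded, `F` can be cut off outside the range of `u` to a Lipschitz function.
  set R := (eLpNorm u ⊤ volume).toReal + 1
  have hR : 0 < R := by positivity
  obtain ⟨H, K, hH, hK, hHF⟩ := exists_lipschitzWith_eventuallyEq hF hR
  have hae : ∀ᵐ x, |u x| < R := (ae_abs_le_eLpNorm_top hbdd).mono fun x hx => by linarith
  have hcomp : (fun x => H (u x)) =ᵐ[volume] fun x => F (u x) :=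
    hae.mono fun x hx => (hHF _ hx).eq_of_nhds
  have hH₀ : H 0 = 0 := by rw [(hHF 0 (by simpa)).eq_of_nhds, hF₀]
  obtain ⟨hmem, hgrad⟩ := hW.comp_lipschitz hp hH hH₀ hK
  refine ⟨⟨hmem.congr hcomp, ?_, (hK.comp_memLp hH₀ hbdd).ae_eq hcomp⟩, ?_⟩
  · refine (hVu.const_mul ((K : ℝ) ^ p)).mono ((hV.mul ((hF.continuous.measurable.comp_aemeasurable
      hW.1.1.1.aemeasurable).norm.pow_const p)).aestronglyMeasurable) ?_
    filter_upwards [hcomp] with x hx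
    have hle : |F (u x)| ≤ K * |u x| := by simpa [hH₀, hx] using hK.norm_sub_le (u x) 0
    have hpow := Real.rpow_le_rpow (abs_nonneg _) hle (zero_le_one.trans hp)
    rw [Real.mul_rpow K.coe_nonneg (abs_nonneg _)] at hpow
    simp only [norm_mul, Real.norm_eq_abs, Real.abs_rpow_of_nonneg (abs_nonneg _), abs_abs,
      abs_of_nonneg K.coe_nonneg, Real.abs_rpow_of_nonneg K.coe_nonneg]
    nlinarith [mul_le_mul_of_nonneg_left hpow (abs_nonneg (V x))]
  · rw [← weakGrad_congr hcomp]
    filter_upwards [hgrad, hae] with x hx hux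
    rw [hx, (hHF _ hux).deriv_eq]

end ChainRule

end SobolevSpaces

section SobolevExponents

variable {N : ℕ} {p q m : ℝ}

/-- The embeddings `W_0^{1,p}(Ω) ↪ L^m` hold with a constant independent of `Ω`, so that the
estimates derived from them are uniform in `Ω`. -/
def IsSobolevExponent (N : ℕ) (p m : ℝ) : Prop :=
  ∃ C : NNReal, ∀ (Ω : Set (E N)) (u : E N → ℝ), MemWZero p Ω u →
    eLpNorm' u m volume ≤ C * (eLpNorm' u p volume + eLpNorm' (weakGrad u) p volume)

lemma isSobolevExponent_mul {χ : NNReal} {γ p' : ℝ} (hχ : NNReal.HolderConjugate N χ)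
    (hpp' : p.HolderConjugate p') (hpγ : p ≤ γ) (hγ : p' * (γ - 1) ≤ χ * γ) :
    IsSobolevExponent N p (χ * γ) := by
  obtain ⟨C, hC⟩ := exists_eLpNorm'_le_mul_add_eLpNorm'_fderiv (X := E N) (F := ℝ) (μ := volume)
    (by rwa [finrank_euclideanSpace_fin]) hpp' hpγ hγ
  refine ⟨C, fun Ω u hu => ?_⟩
  have hp₁ := ENNReal.one_le_ofReal.2 hpp'.lt.le
  have heq {G : Type} [NormedAddCommGroup G] (f : E N → G) :
      eLpNorm' f p volume = eLpNorm f (ENNReal.ofReal p) volume := by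
    rw [eLpNorm_eq_eLpNorm' (ENNReal.ofReal_pos.2 hpp'.pos).ne' ENNReal.ofReal_ne_top,
      ENNReal.toReal_ofReal hpp'.nonneg]
  obtain ⟨φ, hφ, hφu, hφw, hae⟩ := hu.exists_tendsto_ae hpp'.pos
  have hφ₁ (n : ℕ) : ContDiff ℝ 1 (φ n) := (hφ n).1.of_le (by exact_mod_cast le_top)
  have hbound (n : ℕ) : eLpNorm' (φ n) (χ * γ) volume ≤ C * (eLpNorm u (ENNReal.ofReal p) volume +
      eLpNorm (fun x => u x - φ n x) (ENNReal.ofReal p) volume +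
      (eLpNorm (weakGrad u) (ENNReal.ofReal p) volume +
        eLpNorm (fun x => weakGrad u x - gradient (φ n) x) (ENNReal.ofReal p) volume)) := by
    refine (hC (φ n) (hφ₁ n) (hφ n).2.1).trans ?_
    gcongr
    · rw [heq]
      exact eLpNorm_le_add_eLpNorm_sub hp₁ hu.1.1.1 (hφ n).1.continuous.aestronglyMeasurable
    · rw [heq, ← eLpNorm_congr_norm_ae (Eventually.of_forall (norm_gradient (φ n)))]
      exact eLpNorm_le_add_eLpNorm_sub hp₁ hu.1.memLp_weakGrad.1
        (continuous_gradient (hφ₁ n)).aestronglyMeasurable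
  have hlim := ENNReal.Tendsto.const_mul (a := (C : ℝ≥0∞))
    ((hφu.const_add (eLpNorm u (ENNReal.ofReal p) volume)).add
      (hφw.const_add (eLpNorm (weakGrad u) (ENNReal.ofReal p) volume))) (Or.inr (by finiteness))
  rw [add_zero, add_zero] at hlim
  rw [heq, heq, ← hlim.liminf_eq]
  have hχγ : 0 < χ * γ := mul_pos hχ.symm.pos (hpp'.pos.trans_le hpγ)
  exact (Lp.eLpNorm'_lim_le_liminf_eLpNorm' hχγ
    (fun n => (hφ n).1.continuous.aestronglyMeasurable) hae).trans
    (liminf_le_liminf (Eventually.of_forall hbound))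

lemma exists_isSobolevExponent_gt (hN : 2 ≤ N) (hp : 1 < p)
    (hq : (q : EReal) < criticalExponent N p) : ∃ m > q, IsSobolevExponent N p m := by
  have hχ : NNReal.HolderConjugate N (NNReal.conjExponent N) :=
    .conjExponent (by exact_mod_cast hN)
  have hpp' : p.HolderConjugate p.conjExponent := .conjExponent hp
  obtain ⟨γ, hpγ, hγ, hqγ⟩ := exists_gagliardo_exponent hχ hpp' hq
  exact ⟨_, hqγ, isSobolevExponent_mul hχ hpp' hpγ hγ⟩

lemma IsSobolevExponent.exists_eLpNorm'_rpow_le (h : IsSobolevExponent N p m) (hp : 1 ≤ p) :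
    ∃ K : NNReal, ∀ (Ω : Set (E N)) (u : E N → ℝ), MemWZero p Ω u →
      eLpNorm' u m volume ^ p ≤
        K * (eLpNorm' u p volume ^ p + eLpNorm' (weakGrad u) p volume ^ p) := by
  obtain ⟨C, hC⟩ := h
  have hp₀ : 0 ≤ p := by linarith
  refine ⟨C ^ p * 2 ^ (p - 1), fun Ω u hu => ?_⟩
  calc eLpNorm' u m volume ^ p
      ≤ (C * (eLpNorm' u p volume + eLpNorm' (weakGrad u) p volume)) ^ p :=
        ENNReal.rpow_le_rpow (hC Ω u hu) hp₀
    _ ≤ C ^ p * (2 ^ (p - 1) *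
          (eLpNorm' u p volume ^ p + eLpNorm' (weakGrad u) p volume ^ p)) := by
        rw [ENNReal.mul_rpow_of_nonneg _ _ hp₀]
        gcongr
        exact ENNReal.rpow_add_le_mul_rpow_add_rpow _ _ hp
    _ = _ := by
        rw [← mul_assoc, ENNReal.coe_mul, ENNReal.coe_rpow_of_nonneg _ hp₀,
          ENNReal.coe_rpow_of_nonneg _ (sub_nonneg.2 hp), ENNReal.coe_ofNat]

end SobolevExponents

section Superposition

variable {α : Type*} [MeasurableSpace α] {μ : Measure α} {b : α → ℝ → ℝ} {u f : α → ℝ}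

lemma aemeasurable_comp_of_ae_continuous (hm : ∀ t, AEMeasurable (fun x => b x t) μ)
    (hc : ∀ᵐ x ∂μ, Continuous (b x)) (hu : AEMeasurable u μ) :
    AEMeasurable (fun x => b x (u x)) μ := by
  have hs : StronglyMeasurable (hu.mk u) := hu.measurable_mk.stronglyMeasurable
  have hsimple (n : ℕ) : AEMeasurable (fun x => b x (hs.approx n x)) μ := by
    have hsum : (fun x => b x (hs.approx n x)) = ∑ c ∈ (hs.approx n).range,
        (hs.approx n ⁻¹' {c}).indicator (fun x => b x c) := by
      ext x
      rw [Finset.sum_apply, Finset.sum_eq_single (hs.approx n x)]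
      · simp
      · intro c _ hc
        exact indicator_of_notMem (by simpa using hc.symm) _
      · exact fun hx => absurd (SimpleFunc.mem_range_self _ x) hx
    rw [hsum]
    exact Finset.aemeasurable_sum _ fun c _ =>
      (hm c).indicator ((hs.approx n).measurableSet_fiber c)
  have hlim : AEMeasurable (fun x => b x (hu.mk u x)) μ :=
    aemeasurable_of_tendsto_metrizable_ae atTop hsimple
      (hc.mono fun x hx => (hx.tendsto _).comp (hs.tendsto_approx x))
  exact hlim.congr (hu.ae_eq_mk.mono fun x hx => by simp only [hx])

lemma integrable_comp_mul (hm : ∀ t, AEMeasurable (fun x => b x t) μ)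
    (hc : ∀ᵐ x ∂μ, Continuous (b x))
    (hb : ∀ ρ > 0, ∃ C, ∀ᵐ x ∂μ, ∀ t, |t| ≤ ρ → |b x t| ≤ C) (hu : MemLp u ⊤ μ)
    (hf : Integrable f μ) : Integrable (fun x => b x (u x) * f x) μ := by
  obtain ⟨C, hC⟩ := hb ((eLpNorm u ⊤ μ).toReal + 1) (by positivity)
  refine hf.bdd_mul (c := C)
    (aemeasurable_comp_of_ae_continuous hm hc hu.1.aemeasurable).aestronglyMeasurable ?_
  filter_upwards [hC, ae_abs_le_eLpNorm_top hu] with x hx hux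
  exact hx _ (by linarith)

lemma integrable_continuous_comp_mul {H : ℝ → ℝ} (hH : Continuous H) (hu : MemLp u ⊤ μ)
    (hf : Integrable f μ) : Integrable (fun x => H (u x) * f x) μ := by
  refine integrable_comp_mul (b := fun _ => H) (fun t => aemeasurable_const)
    (Eventually.of_forall fun _ => hH) (fun ρ _ => ?_) hu hf
  obtain ⟨C, hC⟩ := (isCompact_Icc (a := -ρ) (b := ρ)).exists_bound_of_continuousOn hH.continuousOn
  exact ⟨C, Eventually.of_forall fun _ t ht => hC t (abs_le.1 ht)⟩

lemma abs_rpow_sub_mul_rpow {p r t : ℝ} (hp : 0 < p) (hr : p ≤ r) :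
    |t| ^ (r - p) * |t| ^ p = |t| ^ r := by
  rw [← Real.rpow_add_of_nonneg (abs_nonneg t) (sub_nonneg.2 hr) hp.le, sub_add_cancel]

lemma integrable_mul_abs_rpow {p r : ℝ} (hp : 0 < p) (hr : p ≤ r) (hu : MemLp u ⊤ μ)
    (hf : Integrable (fun x => f x * |u x| ^ p) μ) : Integrable (fun x => f x * |u x| ^ r) μ := by
  refine (integrable_continuous_comp_mul (H := fun t => |t| ^ (r - p))
    (continuous_abs.rpow_const fun _ => Or.inr (sub_nonneg.2 hr)) hu hf).congr
    (Eventually.of_forall fun x => ?_)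
  simp only
  rw [mul_left_comm, abs_rpow_sub_mul_rpow hp hr]

variable {G : Type*} [NormedAddCommGroup G] {w : α → G} {p : ℝ}

lemma integrable_norm_rpow (hp : 0 < p) (hw : MemLp w (ENNReal.ofReal p) μ) :
    Integrable (fun x => ‖w x‖ ^ p) μ := by
  simpa [ENNReal.toReal_ofReal hp.le] using
    hw.integrable_norm_rpow (by simpa using hp) ENNReal.ofReal_ne_top

lemma eLpNorm'_rpow_eq_ofReal_integral (hp : 0 < p) (hw : Integrable (fun x => ‖w x‖ ^ p) μ) :
    eLpNorm' w p μ ^ p = ENNReal.ofReal (∫ x, ‖w x‖ ^ p ∂μ) := by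
  rw [← lintegral_rpow_enorm_eq_rpow_eLpNorm' hp,
    ofReal_integral_eq_lintegral_ofReal hw (Eventually.of_forall fun x => by positivity)]
  simp only [← ofReal_norm, ENNReal.ofReal_rpow_of_nonneg (norm_nonneg _) hp.le]

end Superposition

section CriticalPoints

variable {N : ℕ} {p q μ α₀ : ℝ} {Ω : Set (E N)} {A g : E N → ℝ → ℝ} {V u : E N → ℝ} {θ : ℝ → ℝ}

lemma IsCaratheodory.ae_continuous {k : ℕ} {h : E N → ℝ → ℝ} (hh : IsCaratheodory k h) :
    ∀ᵐ x, Continuous (h x) :=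
  hh.2.mono fun _ hx => hx.continuous

lemma IsCaratheodory.partialT (hA : IsCaratheodory 1 A) : IsCaratheodory 0 (partialT A) := by
  refine ⟨fun t => ?_, hA.2.mono fun x hx => contDiff_zero.2 (hx.continuous_deriv le_rfl)⟩
  refine aemeasurable_of_tendsto_metrizable_ae atTop
    (f := fun (n : ℕ) x => ((1 : ℝ) / (n + 1))⁻¹ • (A x (t + 1 / (n + 1)) - A x t))
    (fun n => ((hA.1 (t + 1 / (n + 1))).sub (hA.1 t)).const_smul ((1 : ℝ) / (n + 1))⁻¹) ?_
  filter_upwards [hA.2] with x hx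
  have hd : HasDerivAt (A x) (deriv (A x) t) t := (hx.differentiable (by simp) t).hasDerivAt
  refine (hasDerivAt_iff_tendsto_slope_zero.1 hd).comp (tendsto_nhdsWithin_iff.2
    ⟨tendsto_one_div_add_atTop_nhds_zero_nat, Eventually.of_forall fun n => ?_⟩)
  exact (one_div_pos.2 n.cast_add_one_pos).ne'

lemma integrable_comp_mul_of_hypH1 {f : E N → ℝ} (hA₀ : IsCaratheodory 1 A) (hA₁ : HypH1 A)
    (hu : MemLp u ⊤ volume) (hf : Integrable f volume) :
    Integrable (fun x => A x (u x) * f x) volume ∧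
      Integrable (fun x => partialT A x (u x) * f x) volume := by
  constructor
  · refine integrable_comp_mul hA₀.1 hA₀.ae_continuous (fun ρ hρ => ?_) hu hf
    exact (hA₁ ρ hρ).imp fun C hC => hC.mono fun x hx t ht => (hx t ht).1
  · refine integrable_comp_mul hA₀.partialT.1 hA₀.partialT.ae_continuous (fun ρ hρ => ?_) hu hf
    exact (hA₁ ρ hρ).imp fun C hC => hC.mono fun x hx t ht => (hx t ht).2

lemma MemXZero.integrable_abs_rpow {r : ℝ} (hp : 0 < p) (hr : p ≤ r) (hu : MemXZero V p Ω u) :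
    Integrable (fun x => |u x| ^ r) volume := by
  simpa only [one_mul] using integrable_mul_abs_rpow (f := fun _ => 1) hp hr hu.2.2
    (by simpa only [one_mul, Real.norm_eq_abs] using integrable_norm_rpow hp hu.1.1.1)

lemma MemXZero.integrable_norm_weakGrad_rpow (hp : 0 < p) (hu : MemXZero V p Ω u) :
    Integrable (fun x => ‖weakGrad u x‖ ^ p) volume :=
  integrable_norm_rpow hp hu.1.1.memLp_weakGrad

lemma HypG1.exists_abs_mul_self_le (hp : 1 < p) (hg : HypG1 p q g) :
    ∃ a > 0, ∀ᵐ x : E N, ∀ t, |g x t * t| ≤ a * (|t| ^ p + |t| ^ q) := by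
  obtain ⟨hpq, a₁, ha₁, a₂, -, hle⟩ := hg
  refine ⟨max a₁ a₂, lt_max_of_lt_left ha₁, hle.mono fun x hx t => ?_⟩
  have hpow {r : ℝ} (hr : 1 < r) : |t| ^ (r - 1) * |t| = |t| ^ r := by
    simpa using abs_rpow_sub_mul_rpow (t := t) one_pos hr.le
  calc |g x t * t| ≤ (a₁ * |t| ^ (p - 1) + a₂ * |t| ^ (q - 1)) * |t| := by
        rw [abs_mul]; gcongr; exact hx t
    _ = a₁ * |t| ^ p + a₂ * |t| ^ q := by
        rw [add_mul, mul_assoc, mul_assoc, hpow hp, hpow (hp.trans_le hpq)]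
    _ ≤ max a₁ a₂ * (|t| ^ p + |t| ^ q) := by
        rw [mul_add]; gcongr; exacts [le_max_left _ _, le_max_right _ _]

lemma MemXZero.integrable_abs_rpow_add (hp : 0 < p) (hpq : p ≤ q) (hu : MemXZero V p Ω u) :
    Integrable (fun x => |u x| ^ p + |u x| ^ q) volume :=
  (hu.integrable_abs_rpow hp le_rfl).add (hu.integrable_abs_rpow hp hpq)

lemma MemXZero.integrable_nonlinearity_mul_self (hp : 1 < p) (hg₀ : IsCaratheodory 0 g)
    (hg₁ : HypG1 p q g) (hu : MemXZero V p Ω u) :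
    Integrable (fun x => g x (u x) * u x) volume := by
  obtain ⟨a, -, ha⟩ := hg₁.exists_abs_mul_self_le hp
  have hum := hu.1.1.1.1.aemeasurable
  refine ((hu.integrable_abs_rpow_add (by linarith) hg₁.1).const_mul a).mono'
    ((aemeasurable_comp_of_ae_continuous hg₀.1 hg₀.ae_continuous hum).mul
      hum).aestronglyMeasurable (ha.mono fun x hx => hx (u x))

/-- `u ∈ X_Ω` is a critical point of the restriction of `J` to `X_Ω`; here `Ω` is any set, and the
terms `u_k` correspond to `Ω = B_k`. -/
def IsCriticalOn (p : ℝ) (A : E N → ℝ → ℝ) (V : E N → ℝ) (g : E N → ℝ → ℝ) (Ω : Set (E N))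
    (u : E N → ℝ) : Prop :=
  MemXZero V p Ω u ∧ ∀ v : E N → ℝ, MemXZero V p Ω v → dJ p A V g u v = 0

lemma rpow_sub_two_mul_self {a : ℝ} (hp : 0 < p) (ha : 0 ≤ a) : a ^ (p - 2) * (a * a) = a ^ p := by
  rcases ha.eq_or_lt with rfl | ha
  · simp [hp.ne']
  · rw [← pow_two, ← Real.rpow_natCast a 2, ← Real.rpow_add ha]
    norm_num

-- The equation tested with `v = θ(u) u`.
lemma IsCriticalOn.integral_test_eq (hp : 1 < p) (hV : AEMeasurable V volume)
    (hA₀ : IsCaratheodory 1 A) (hA₁ : HypH1 A) (hu : IsCriticalOn p A V g Ω u)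
    (hθ : ContDiff ℝ ∞ θ) :
    (∫ x, (θ (u x) * (A x (u x) + 1 / p * (partialT A x (u x) * u x))
        + u x * deriv θ (u x) * A x (u x)) * ‖weakGrad u x‖ ^ p)
      + ∫ x, θ (u x) * (V x * |u x| ^ p) = ∫ x, θ (u x) * (g x (u x) * u x) := by
  obtain ⟨hX, hcrit⟩ := hu
  have hp₀ : 0 < p := by linarith
  have hF : ContDiff ℝ ∞ fun t => θ t * t := hθ.mul contDiff_id
  have hderiv (t : ℝ) : deriv (fun t => θ t * t) t = deriv θ t * t + θ t := by
    simpa using deriv_fun_mul (hθ.differentiable (by simp) t) differentiableAt_id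
  obtain ⟨hv, hgrad⟩ := hX.comp hp.le hV hF (mul_zero _)
  have hw := hX.integrable_norm_weakGrad_rpow hp₀
  have hint {H : ℝ → ℝ} (hH : Continuous H) :=
    integrable_comp_mul_of_hypH1 hA₀ hA₁ hX.2.2 (integrable_continuous_comp_mul hH hX.2.2 hw)
  have hdiff : ∫ x, A x (u x) * ‖weakGrad u x‖ ^ (p - 2)
      * inner ℝ (weakGrad u x) (weakGrad (fun x => θ (u x) * u x) x)
      = ∫ x, A x (u x) * (deriv (fun t => θ t * t) (u x) * ‖weakGrad u x‖ ^ p) := by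
    refine integral_congr_ae (hgrad.mono fun x hx => ?_)
    simp only
    rw [hx, real_inner_smul_right, real_inner_self_eq_norm_mul_norm,
      ← rpow_sub_two_mul_self hp₀ (norm_nonneg _)]
    ring
  have hpot : ∫ x, V x * |u x| ^ (p - 2) * u x * (θ (u x) * u x)
      = ∫ x, θ (u x) * (V x * |u x| ^ p) := by
    refine integral_congr_ae (Eventually.of_forall fun x => ?_)
    simp only [← rpow_sub_two_mul_self hp₀ (abs_nonneg (u x)), abs_mul_abs_self]
    ring
  have htest := hcrit _ hv
  rw [dJ, hdiff, hpot, sub_eq_zero, ← integral_const_mul, ← integral_add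
    (hint (hF.continuous_deriv (by simp))).1 (by
      simpa only [mul_assoc] using (hint hF.continuous).2.const_mul (1 / p))] at htest
  convert htest using 2
  · refine integral_congr_ae (Eventually.of_forall fun x => ?_)
    simp only [hderiv]
    ring
  · ext x
    ring

lemma HypG3.integral_primitive_le (hg : HypG3 μ g)
    (hint : Integrable (fun x => g x (u x) * u x) volume) :
    μ * ∫ x, primitive g x (u x) ≤ ∫ x, g x (u x) * u x := by
  have hprim : ∀ᵐ x, 0 ≤ μ * primitive g x (u x) ∧ μ * primitive g x (u x) ≤ g x (u x) * u x := by
    filter_upwards [hg] with x hx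
    rcases eq_or_ne (u x) 0 with h | h
    · simp [h, primitive]
    · exact ⟨(hx _ h).1.le, (hx _ h).2⟩
  rw [← integral_const_mul]
  exact integral_mono_of_nonneg (hprim.mono fun x hx => hx.1) hint (hprim.mono fun x hx => hx.2)

lemma IsCriticalOn.energy_le {α₁ : ℝ} (hp : 1 < p) (hV : AEMeasurable V volume)
    (hA₀ : IsCaratheodory 1 A) (hA₁ : HypH1 A) (hA₂ : HypH2 α₀ A) (hα₁ : 0 < α₁)
    (hA₃ : ∀ᵐ x : E N, ∀ t : ℝ, α₁ * A x t ≤ (μ - p) * A x t - partialT A x t * t)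
    (hg₀ : IsCaratheodory 0 g) (hg₁ : HypG1 p q g) (hg₃ : HypG3 μ g)
    (hu : IsCriticalOn p A V g Ω u) :
    α₁ * α₀ * (∫ x, ‖weakGrad u x‖ ^ p) + (μ - p) * (∫ x, V x * |u x| ^ p) ≤
      p * μ * J p A V g u := by
  have hp₀ : 0 < p := by linarith
  have hX := hu.1
  have hw := hX.integrable_norm_weakGrad_rpow hp₀
  have hA := (integrable_comp_mul_of_hypH1 hA₀ hA₁ hX.2.2 hw).1
  have hA' : Integrable (fun x => partialT A x (u x) * u x * ‖weakGrad u x‖ ^ p) volume := by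
    simpa only [mul_assoc, id] using (integrable_comp_mul_of_hypH1 hA₀ hA₁ hX.2.2
      (integrable_continuous_comp_mul continuous_id hX.2.2 hw)).2
  have hprim := hg₃.integral_primitive_le
    (hX.integrable_nonlinearity_mul_self hp hg₀ hg₁)
  have htest := hu.integral_test_eq (θ := fun _ => 1) hp hV hA₀ hA₁ contDiff_const
  simp only [one_mul, deriv_const, mul_zero, zero_mul, add_zero, add_mul, mul_assoc] at htest hA'
  rw [integral_add hA (hA'.const_mul _), integral_const_mul] at htest
  have hcoer : α₁ * α₀ * (∫ x, ‖weakGrad u x‖ ^ p) ≤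
      (μ - p) * (∫ x, A x (u x) * ‖weakGrad u x‖ ^ p)
        - ∫ x, partialT A x (u x) * (u x * ‖weakGrad u x‖ ^ p) := by
    rw [← integral_const_mul, ← integral_const_mul, ← integral_sub (hA.const_mul _) hA']
    refine integral_mono_ae (hw.const_mul _) ((hA.const_mul _).sub hA') ?_
    filter_upwards [hA₂.2, hA₃] with x h₂ h₃
    calc α₁ * α₀ * ‖weakGrad u x‖ ^ p
        ≤ ((μ - p) * A x (u x) - partialT A x (u x) * u x) * ‖weakGrad u x‖ ^ p := by
          gcongr
          exact (mul_le_mul_of_nonneg_left (h₂ _) hα₁.le).trans (h₃ _)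
      _ = _ := by ring
  have hJ : p * J p A V g u = (∫ x, A x (u x) * ‖weakGrad u x‖ ^ p) + (∫ x, V x * |u x| ^ p)
      - p * ∫ x, primitive g x (u x) := by
    rw [J]
    field_simp
  have hpt : p * (∫ x, g x (u x) * u x) = p * (∫ x, A x (u x) * ‖weakGrad u x‖ ^ p)
      + (∫ x, partialT A x (u x) * (u x * ‖weakGrad u x‖ ^ p)) + p * ∫ x, V x * |u x| ^ p := by
    rw [← htest]
    field_simp
  linear_combination hcoer + p * hprim - μ * hJ + hpt

lemma HypV1.ae_nonneg (hV : HypV1 V) : ∀ᵐ x, 0 ≤ V x :=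
  let ⟨_, hc, h⟩ := hV
  h.mono fun _ hx => hc.le.trans hx

lemma HypV1.integral_mul_abs_rpow_nonneg (hV : HypV1 V) (r : ℝ) :
    0 ≤ ∫ x, V x * |u x| ^ r :=
  integral_nonneg_of_ae (hV.ae_nonneg.mono fun x hx => by dsimp; positivity)

lemma exists_forall_integral_le_of_J_le (hp : 1 < p) (hV : AEMeasurable V volume) (hV₁ : HypV1 V)
    (hA₀ : IsCaratheodory 1 A) (hA₁ : HypH1 A) (hA₂ : HypH2 α₀ A) (hA₃ : HypH3 p μ A)
    (hg₀ : IsCaratheodory 0 g) (hg₁ : HypG1 p q g) (hg₃ : HypG3 μ g) (c : ℝ) :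
    ∃ S : ℝ, 1 ≤ S ∧ ∀ (Ω : Set (E N)) (u : E N → ℝ), IsCriticalOn p A V g Ω u →
      J p A V g u ≤ c → (∫ x, ‖weakGrad u x‖ ^ p) ≤ S ∧ (∫ x, V x * |u x| ^ p) ≤ S ∧
        (∫ x, |u x| ^ p) ≤ S := by
  obtain ⟨hμ, α₁, hα₁, hA₃⟩ := hA₃
  obtain ⟨v, hv, hVv⟩ := id hV₁
  have hp₀ : 0 < p := by linarith
  set k := min (α₁ * α₀) (min (μ - p) ((μ - p) * v))
  have hk : 0 < k := lt_min (mul_pos hα₁ hA₂.1)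
    (lt_min (sub_pos.2 hμ) (mul_pos (sub_pos.2 hμ) hv))
  refine ⟨max 1 (p * μ * c / k), le_max_left _ _, fun Ω u hu hJ => ?_⟩
  have hgrad : 0 ≤ ∫ x, ‖weakGrad u x‖ ^ p := integral_nonneg fun x => by positivity
  have hpot := hV₁.integral_mul_abs_rpow_nonneg (u := u) p
  have hmass : 0 ≤ ∫ x, |u x| ^ p := integral_nonneg fun x => by positivity
  have hle : v * (∫ x, |u x| ^ p) ≤ ∫ x, V x * |u x| ^ p := by
    rw [← integral_const_mul]
    exact integral_mono_ae ((hu.1.integrable_abs_rpow hp₀ le_rfl).const_mul v) hu.1.2.1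
      (hVv.mono fun x hx => mul_le_mul_of_nonneg_right hx (by positivity))
  have henergy := (hu.energy_le hp hV hA₀ hA₁ hA₂ hα₁ hA₃ hg₀ hg₁ hg₃).trans
    (mul_le_mul_of_nonneg_left hJ (by positivity [hp₀.trans hμ]))
  have hbound {y : ℝ} (hy : k * y ≤ p * μ * c) : y ≤ max 1 (p * μ * c / k) :=
    le_max_of_le_right ((le_div_iff₀' hk).2 hy)
  have hk₁ : k ≤ α₁ * α₀ := min_le_left _ _
  have hk₂ : k ≤ μ - p := (min_le_right _ _).trans (min_le_left _ _)
  have hk₃ : k ≤ (μ - p) * v := (min_le_right _ _).trans (min_le_right _ _)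
  refine ⟨hbound ?_, hbound ?_, hbound ?_⟩ <;>
    nlinarith

lemma mul_integral_mul_weakGrad_le {α₂ : ℝ} (hp : 0 < p) (hA₀ : IsCaratheodory 1 A)
    (hA₁ : HypH1 A) (hA₂ : HypH2 α₀ A) (hα₂ : 0 < α₂)
    (hA₄ : ∀ᵐ x : E N, ∀ t : ℝ, α₂ * A x t ≤ p * A x t + partialT A x t * t)
    (hu : MemXZero V p Ω u) (hθ : ContDiff ℝ ∞ θ) (hθ₀ : ∀ t, 0 ≤ θ t)
    (hθ' : ∀ t, 0 ≤ t * deriv θ t) :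
    α₂ * α₀ / p * ∫ x, θ (u x) * ‖weakGrad u x‖ ^ p ≤
      ∫ x, (θ (u x) * (A x (u x) + 1 / p * (partialT A x (u x) * u x))
        + u x * deriv θ (u x) * A x (u x)) * ‖weakGrad u x‖ ^ p := by
  have hw := hu.integrable_norm_weakGrad_rpow hp
  have hint {H : ℝ → ℝ} (hH : Continuous H) := integrable_continuous_comp_mul hH hu.2.2 hw
  have hAw {H : ℝ → ℝ} (hH : Continuous H) :=
    integrable_comp_mul_of_hypH1 hA₀ hA₁ hu.2.2 (hint hH)
  have hθ₁ : Continuous (deriv θ) := hθ.continuous_deriv (by simp)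
  rw [← integral_const_mul]
  refine integral_mono_ae ((hint hθ.continuous).const_mul _)
    ((((hAw hθ.continuous).1.add ((hAw (hθ.continuous.mul continuous_id)).2.const_mul (1 / p))).add
      (hAw (continuous_id.mul hθ₁)).1).congr (Eventually.of_forall fun x => ?_)) ?_
  · simp only [Pi.add_apply, Pi.mul_apply, id]
    ring
  filter_upwards [hA₂.2, hA₄] with x h₂ h₄
  have hA : 0 ≤ u x * deriv θ (u x) * A x (u x) :=
    mul_nonneg (hθ' _) (hA₂.1.le.trans (h₂ _))
  have hlow : α₂ * α₀ / p ≤ A x (u x) + 1 / p * (partialT A x (u x) * u x) := by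
    rw [div_le_iff₀ hp]
    refine ((mul_le_mul_of_nonneg_left (h₂ (u x)) hα₂.le).trans (h₄ (u x))).trans_eq ?_
    field_simp
  rw [← mul_assoc]
  refine mul_le_mul_of_nonneg_right ?_ (by positivity)
  nlinarith [mul_le_mul_of_nonneg_left hlow (hθ₀ (u x))]

lemma exists_forall_integral_mul_weakGrad_le (hp : 1 < p) (hV : AEMeasurable V volume)
    (hV₁ : HypV1 V) (hA₀ : IsCaratheodory 1 A) (hA₁ : HypH1 A) (hA₂ : HypH2 α₀ A)
    (hA₄ : HypH4 p A) (hg₀ : IsCaratheodory 0 g) (hg₁ : HypG1 p q g) :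
    ∃ C : ℝ, 0 ≤ C ∧ ∀ (Ω : Set (E N)) (u : E N → ℝ), IsCriticalOn p A V g Ω u →
      ∀ θ : ℝ → ℝ, ContDiff ℝ ∞ θ → (∀ t, 0 ≤ θ t) → (∀ t, 0 ≤ t * deriv θ t) →
        ∫ x, θ (u x) * ‖weakGrad u x‖ ^ p ≤ C * ∫ x, θ (u x) * (|u x| ^ p + |u x| ^ q) := by
  obtain ⟨α₂, hα₂, hA₄⟩ := hA₄
  obtain ⟨a, ha, hga⟩ := hg₁.exists_abs_mul_self_le hp
  have hα₀ := hA₂.1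
  have hp₀ : 0 < p := by linarith
  refine ⟨a / (α₂ * α₀ / p), by positivity, fun Ω u hu θ hθ hθ₀ hθ' => ?_⟩
  have hX := hu.1
  have hint {H : ℝ → ℝ} (hH : Continuous H) {f : E N → ℝ} (hf : Integrable f volume) :=
    integrable_continuous_comp_mul hH hX.2.2 hf
  have hpot : 0 ≤ ∫ x, θ (u x) * (V x * |u x| ^ p) :=
    integral_nonneg_of_ae (hV₁.ae_nonneg.mono fun x hx =>
      mul_nonneg (hθ₀ _) (mul_nonneg hx (by positivity)))
  have hnonlin : ∫ x, θ (u x) * (g x (u x) * u x) ≤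
      a * ∫ x, θ (u x) * (|u x| ^ p + |u x| ^ q) := by
    rw [← integral_const_mul]
    refine integral_mono_ae
      (hint hθ.continuous (hX.integrable_nonlinearity_mul_self hp hg₀ hg₁))
      ((hint hθ.continuous (hX.integrable_abs_rpow_add hp₀ hg₁.1)).const_mul a) ?_
    filter_upwards [hga] with x hx
    exact (mul_le_mul_of_nonneg_left ((le_abs_self _).trans (hx _)) (hθ₀ _)).trans_eq
      (mul_left_comm _ _ _)
  have hgrad := mul_integral_mul_weakGrad_le hp₀ hA₀ hA₁ hA₂ hα₂ hA₄ hX hθ hθ₀ hθ'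
  rw [div_mul_eq_mul_div, le_div_iff₀' (by positivity)]
  linarith [hu.integral_test_eq hp hV hA₀ hA₁ hθ]

end CriticalPoints

section RegularizedPower

/-- The smooth regularization `(t² + ε)^{s/2}` of the weight `|t|^s`, which makes `|u|^s u` an
admissible test function. -/
noncomputable def regPow (ε s t : ℝ) : ℝ := (t ^ 2 + ε) ^ (s / 2)

variable {ε s t p : ℝ}

lemma regPow_zero : regPow 0 s t = |t| ^ s := by
  rw [regPow, add_zero, Real.rpow_div_two_eq_sqrt _ (sq_nonneg t), Real.sqrt_sq_eq_abs]

lemma regPow_nonneg (hε : 0 ≤ ε) : 0 ≤ regPow ε s t := by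
  unfold regPow
  positivity

lemma regPow_le_regPow {ε' : ℝ} (hε : 0 ≤ ε) (hs : 0 ≤ s) (h : ε ≤ ε') :
    regPow ε s t ≤ regPow ε' s t := by
  unfold regPow
  gcongr

lemma abs_rpow_le_regPow (hε : 0 ≤ ε) (hs : 0 ≤ s) : |t| ^ s ≤ regPow ε s t :=
  regPow_zero.symm.trans_le (regPow_le_regPow le_rfl hs hε)

lemma regPow_div_rpow (hp : p ≠ 0) (hε : 0 ≤ ε) : regPow ε (s / p) t ^ p = regPow ε s t := by
  rw [regPow, regPow, ← Real.rpow_mul (by positivity)]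
  congr 1
  field_simp

lemma contDiff_regPow (hε : 0 < ε) : ContDiff ℝ ∞ (regPow ε s) :=
  ContDiff.rpow_const_of_ne (by fun_prop) fun t => by positivity

lemma continuous_regPow_left (hs : 0 ≤ s) : Continuous fun ε => regPow ε s t :=
  (by fun_prop : Continuous fun ε => t ^ 2 + ε).rpow_const fun _ => Or.inr (by positivity)

lemma mul_deriv_regPow (hε : 0 < ε) :
    t * deriv (regPow ε s) t = s * (t ^ 2 * (t ^ 2 + ε) ^ (s / 2 - 1)) := by
  have hbase : HasDerivAt (fun t : ℝ => t ^ 2 + ε) (2 * t) t := by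
    simpa using (hasDerivAt_pow 2 t).add_const ε
  rw [show regPow ε s = fun t => (t ^ 2 + ε) ^ (s / 2) from rfl,
    (hbase.rpow_const (p := s / 2) (Or.inl (by positivity))).deriv]
  ring

lemma mul_deriv_regPow_nonneg (hε : 0 < ε) (hs : 0 ≤ s) : 0 ≤ t * deriv (regPow ε s) t := by
  rw [mul_deriv_regPow hε]
  positivity

lemma mul_deriv_regPow_le (hε : 0 < ε) (hs : 0 ≤ s) :
    t * deriv (regPow ε s) t ≤ s * regPow ε s t := by
  rw [mul_deriv_regPow hε, regPow]
  gcongr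
  calc t ^ 2 * (t ^ 2 + ε) ^ (s / 2 - 1) ≤ (t ^ 2 + ε) * (t ^ 2 + ε) ^ (s / 2 - 1) := by
        gcongr
        linarith
    _ = (t ^ 2 + ε) ^ (s / 2) := by
        rw [mul_comm, ← Real.rpow_add_one (by positivity), sub_add_cancel]

lemma abs_deriv_regPow_mul_self_rpow_le (hε : 0 < ε) (hs : 0 ≤ s) (hp : 1 ≤ p) :
    |deriv (fun t => regPow ε (s / p) t * t) t| ^ p ≤ (p + s) ^ p * regPow ε s t := by
  have hp₀ : 0 < p := by linarith
  have hsp : 0 ≤ s / p := by positivity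
  have hderiv : deriv (fun t => regPow ε (s / p) t * t) t
      = t * deriv (regPow ε (s / p)) t + regPow ε (s / p) t := by
    simpa [mul_comm t] using deriv_fun_mul
      ((contDiff_regPow (s := s / p) hε).differentiable (by simp) t) differentiableAt_id
  have hreg : 0 ≤ regPow ε (s / p) t := regPow_nonneg hε.le
  have hle : |deriv (fun t => regPow ε (s / p) t * t) t| ≤ (p + s) * regPow ε (s / p) t := by
    rw [hderiv, abs_of_nonneg (add_nonneg (mul_deriv_regPow_nonneg hε hsp) hreg)]
    calc t * deriv (regPow ε (s / p)) t + regPow ε (s / p) t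
        ≤ s / p * regPow ε (s / p) t + regPow ε (s / p) t := by
          linarith [mul_deriv_regPow_le hε hsp (t := t)]
      _ = (s / p + 1) * regPow ε (s / p) t := by ring
      _ ≤ (p + s) * regPow ε (s / p) t :=
          mul_le_mul_of_nonneg_right (by linarith [div_le_self hs hp]) hreg
  calc |deriv (fun t => regPow ε (s / p) t * t) t| ^ p
      ≤ ((p + s) * regPow ε (s / p) t) ^ p := by gcongr
    _ = (p + s) ^ p * regPow ε s t := by
        rw [Real.mul_rpow (by positivity) hreg, regPow_div_rpow hp₀.ne' hε.le]

lemma abs_regPow_mul_self_rpow (hε : 0 ≤ ε) (hp : p ≠ 0) :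
    |regPow ε (s / p) t * t| ^ p = regPow ε s t * |t| ^ p := by
  rw [abs_mul, abs_of_nonneg (regPow_nonneg hε),
    Real.mul_rpow (regPow_nonneg hε) (abs_nonneg t), regPow_div_rpow hp hε]

lemma abs_rpow_le_abs_regPow_mul_self (hε : 0 ≤ ε) (hs : 0 ≤ s) (hp : 0 < p) :
    |t| ^ ((p + s) / p) ≤ |regPow ε (s / p) t * t| := by
  rw [abs_mul, abs_of_nonneg (regPow_nonneg hε), add_div, div_self hp.ne', add_comm,
    Real.rpow_add_of_nonneg (abs_nonneg t) (by positivity) zero_le_one, Real.rpow_one]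
  gcongr
  exact abs_rpow_le_regPow hε (by positivity)

lemma eLpNorm'_rpow_le_eLpNorm'_regPow_mul_self {α : Type*} [MeasurableSpace α] {μ : Measure α}
    {u : α → ℝ} {m : ℝ} (hε : 0 ≤ ε) (hs : 0 ≤ s) (hp : 0 < p) (hm : 0 ≤ m) :
    eLpNorm' u (m / p * (p + s)) μ ^ (p + s) ≤
      eLpNorm' (fun x => regPow ε (s / p) (u x) * u x) m μ ^ p := by
  rw [show m / p * (p + s) = m * ((p + s) / p) by ring]
  nth_rw 2 [← div_mul_cancel₀ (p + s) hp.ne']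
  rw [ENNReal.rpow_mul, ← eLpNorm'_norm_rpow u m ((p + s) / p) (by positivity)]
  refine ENNReal.rpow_le_rpow (eLpNorm'_mono_ae hm (Eventually.of_forall fun x => ?_)) hp.le
  rw [Real.norm_of_nonneg (by positivity)]
  exact abs_rpow_le_abs_regPow_mul_self hε hs hp

lemma tendsto_integral_regPow_mul {α : Type*} [MeasurableSpace α] {μ : Measure α} {u f : α → ℝ}
    (hs : 0 ≤ s) (hu : MemLp u ⊤ μ) (hf : Integrable f μ) :
    Tendsto (fun ε => ∫ x, regPow ε s (u x) * f x ∂μ) (𝓝[>] 0)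
      (𝓝 (∫ x, |u x| ^ s * f x ∂μ)) := by
  have hint {ε : ℝ} (hε : 0 < ε) {f : α → ℝ} (hf : Integrable f μ) :
      Integrable (fun x => regPow ε s (u x) * f x) μ :=
    integrable_continuous_comp_mul (contDiff_regPow hε).continuous hu hf
  refine tendsto_integral_filter_of_dominated_convergence _
    (eventually_mem_nhdsWithin.mono fun ε hε => (hint hε hf).1) ?_ (hint one_pos hf.norm)
    (Eventually.of_forall fun x => Tendsto.mul_const _ ?_)
  · filter_upwards [Ioc_mem_nhdsGT one_pos] with ε hε
    refine Eventually.of_forall fun x => ?_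
    rw [norm_mul, Real.norm_of_nonneg (regPow_nonneg hε.1.le)]
    gcongr
    exact regPow_le_regPow hε.1.le hs hε.2
  · rw [← regPow_zero]
    exact (continuous_regPow_left hs).continuousWithinAt

end RegularizedPower

section UniformBounds

variable {N : ℕ} {p q α₀ m : ℝ} {Ω : Set (E N)} {A g : E N → ℝ → ℝ} {V u : E N → ℝ}

lemma MemXZero.regPow_mul_self {ε s : ℝ} (hp : 1 ≤ p) (hV : AEMeasurable V volume)
    (hu : MemXZero V p Ω u) (hε : 0 < ε) (hs : 0 ≤ s) :
    MemXZero V p Ω (fun x => regPow ε (s / p) (u x) * u x) ∧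
      eLpNorm' (fun x => regPow ε (s / p) (u x) * u x) p volume ^ p =
        ENNReal.ofReal (∫ x, regPow ε s (u x) * |u x| ^ p) ∧
      eLpNorm' (weakGrad fun x => regPow ε (s / p) (u x) * u x) p volume ^ p ≤
        ENNReal.ofReal ((p + s) ^ p * ∫ x, regPow ε s (u x) * ‖weakGrad u x‖ ^ p) := by
  have hp₀ : 0 < p := by linarith
  have hF : ContDiff ℝ ∞ fun t => regPow ε (s / p) t * t := (contDiff_regPow hε).mul contDiff_id
  obtain ⟨hv, hgrad⟩ := hu.comp hp hV hF (mul_zero _)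
  refine ⟨hv, ?_, ?_⟩
  · rw [eLpNorm'_rpow_eq_ofReal_integral hp₀ (integrable_norm_rpow hp₀ hv.1.1.1)]
    simp only [Real.norm_eq_abs, abs_regPow_mul_self_rpow hε.le hp₀.ne']
  · rw [eLpNorm'_rpow_eq_ofReal_integral hp₀ (hv.integrable_norm_weakGrad_rpow hp₀),
      ← integral_const_mul]
    refine ENNReal.ofReal_le_ofReal (integral_mono_ae (hv.integrable_norm_weakGrad_rpow hp₀)
      ((integrable_continuous_comp_mul (contDiff_regPow hε).continuous hu.2.2
        (hu.integrable_norm_weakGrad_rpow hp₀)).const_mul _) (hgrad.mono fun x hx => ?_))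
    simp only [hx, norm_smul, Real.norm_eq_abs]
    rw [Real.mul_rpow (abs_nonneg _) (norm_nonneg _), ← mul_assoc]
    gcongr
    exact abs_deriv_regPow_mul_self_rpow_le hε hs hp

lemma MemXZero.tendsto_ofReal_integral_regPow_mul {σ : ℝ} (hp : 0 < p) (hpq : p ≤ q) (hσ : p ≤ σ)
    (hu : MemXZero V p Ω u) :
    Tendsto (fun ε => ENNReal.ofReal (∫ x, regPow ε (σ - p) (u x) * (|u x| ^ p + |u x| ^ q)))
      (𝓝[>] 0) (𝓝 (eLpNorm' u σ volume ^ σ + eLpNorm' u (q - p + σ) volume ^ (q - p + σ))) := by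
  have hσ₀ : 0 < σ := hp.trans_le hσ
  have hτ : p ≤ q - p + σ := by linarith
  have hσi := hu.integrable_abs_rpow hp hσ
  have hτi := hu.integrable_abs_rpow hp hτ
  have hlim : ∫ x, |u x| ^ (σ - p) * (|u x| ^ p + |u x| ^ q) =
      (∫ x, |u x| ^ σ) + ∫ x, |u x| ^ (q - p + σ) := by
    rw [← integral_add hσi hτi]
    refine integral_congr_ae (Eventually.of_forall fun x => ?_)
    simp only
    rw [mul_add, abs_rpow_sub_mul_rpow hp hσ,
      ← Real.rpow_add_of_nonneg (abs_nonneg _) (sub_nonneg.2 hσ) (hp.le.trans hpq),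
      show σ - p + q = q - p + σ by ring]
  have hpow {r : ℝ} (hr : 0 < r) (hi : Integrable (fun x => |u x| ^ r) volume) :
      eLpNorm' u r volume ^ r = ENNReal.ofReal (∫ x, |u x| ^ r) := by
    simp only [← Real.norm_eq_abs] at hi ⊢
    exact eLpNorm'_rpow_eq_ofReal_integral hr hi
  rw [hpow hσ₀ hσi, hpow (hp.trans_le hτ) hτi,
    ← ENNReal.ofReal_add (integral_nonneg fun x => by positivity)
      (integral_nonneg fun x => by positivity), ← hlim]
  exact (ENNReal.continuous_ofReal.tendsto _).comp
    (tendsto_integral_regPow_mul (sub_nonneg.2 hσ) hu.2.2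
      (hu.integrable_abs_rpow_add hp hpq))

lemma MemXZero.integral_regPow_mul_abs_rpow_le {ε s : ℝ} (hp : 0 < p) (hpq : p ≤ q) (hε : 0 < ε)
    (hu : MemXZero V p Ω u) :
    ∫ x, regPow ε s (u x) * |u x| ^ p ≤ ∫ x, regPow ε s (u x) * (|u x| ^ p + |u x| ^ q) := by
  refine integral_mono_of_nonneg
    (Eventually.of_forall fun x => mul_nonneg (regPow_nonneg hε.le) (by positivity))
    (integrable_continuous_comp_mul (contDiff_regPow hε).continuous hu.2.2
      (hu.integrable_abs_rpow_add hp hpq))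
    (Eventually.of_forall fun x => mul_le_mul_of_nonneg_left ?_ (regPow_nonneg hε.le))
  exact le_add_of_nonneg_right (by positivity)

lemma exists_forall_eLpNorm'_rpow_le (hp : 1 < p) (hV : AEMeasurable V volume)
    (hV₁ : HypV1 V) (hA₀ : IsCaratheodory 1 A) (hA₁ : HypH1 A) (hA₂ : HypH2 α₀ A)
    (hA₄ : HypH4 p A) (hg₀ : IsCaratheodory 0 g) (hg₁ : HypG1 p q g)
    (hm : 0 ≤ m) (hS : IsSobolevExponent N p m) :
    ∃ D : ℝ, 1 ≤ D ∧ ∀ (Ω : Set (E N)) (u : E N → ℝ), IsCriticalOn p A V g Ω u → ∀ σ, p ≤ σ →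
      eLpNorm' u (m / p * σ) volume ^ σ ≤ ENNReal.ofReal (D * σ ^ p) *
        (eLpNorm' u σ volume ^ σ + eLpNorm' u (q - p + σ) volume ^ (q - p + σ)) := by
  obtain ⟨K, hK⟩ := hS.exists_eLpNorm'_rpow_le hp.le
  obtain ⟨C, hC₀, hC⟩ := exists_forall_integral_mul_weakGrad_le hp hV hV₁ hA₀ hA₁ hA₂ hA₄ hg₀ hg₁
  have hp₀ : 0 < p := by linarith
  refine ⟨max 1 (K * (1 + C)), le_max_left _ _, fun Ω u hu σ hσ => ?_⟩
  have hs : 0 ≤ σ - p := sub_nonneg.2 hσ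
  refine ge_of_tendsto (ENNReal.Tendsto.const_mul
    (hu.1.tendsto_ofReal_integral_regPow_mul hp₀ hg₁.1 hσ) (Or.inr ENNReal.ofReal_ne_top))
    (eventually_mem_nhdsWithin.mono fun ε (hε : 0 < ε) => ?_)
  obtain ⟨hv, hfun, hgrad⟩ := hu.1.regPow_mul_self hp.le hV hε hs
  have hlow := eLpNorm'_rpow_le_eLpNorm'_regPow_mul_self (u := u) (μ := volume) hε.le hs hp₀ hm
  rw [add_sub_cancel] at hlow hgrad
  set I := ∫ x, regPow ε (σ - p) (u x) * (|u x| ^ p + |u x| ^ q)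
  have hI₀ : 0 ≤ I := integral_nonneg fun x => mul_nonneg (regPow_nonneg hε.le) (by positivity)
  have hmass : ∫ x, regPow ε (σ - p) (u x) * |u x| ^ p ≤ I :=
    hu.1.integral_regPow_mul_abs_rpow_le hp₀ hg₁.1 hε
  have htest : ∫ x, regPow ε (σ - p) (u x) * ‖weakGrad u x‖ ^ p ≤ C * I :=
    hC Ω u hu _ (contDiff_regPow hε) (fun t => regPow_nonneg hε.le)
      fun t => mul_deriv_regPow_nonneg hε hs
  have hone : 1 ≤ σ ^ p := Real.one_le_rpow (by linarith) hp₀.le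
  calc eLpNorm' u (m / p * σ) volume ^ σ
      ≤ K * (ENNReal.ofReal (∫ x, regPow ε (σ - p) (u x) * |u x| ^ p) +
          ENNReal.ofReal (σ ^ p * ∫ x, regPow ε (σ - p) (u x) * ‖weakGrad u x‖ ^ p)) := by
        refine (hlow.trans (hK Ω _ hv.1)).trans ?_
        rw [hfun]
        gcongr
    _ ≤ K * (ENNReal.ofReal (σ ^ p * I) + ENNReal.ofReal (σ ^ p * (C * I))) := by
        gcongr
        exact hmass.trans (le_mul_of_one_le_left hI₀ hone)
    _ = ENNReal.ofReal (K * (1 + C) * σ ^ p) * ENNReal.ofReal I := by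
        rw [← ENNReal.ofReal_add (by positivity) (by positivity), ← ENNReal.ofReal_coe_nnreal,
          ← ENNReal.ofReal_mul K.coe_nonneg, ← ENNReal.ofReal_mul (by positivity)]
        ring_nf
    _ ≤ _ := by
        gcongr
        exact le_max_right _ _

lemma IsSobolevExponent.exists_eLpNorm'_le (h : IsSobolevExponent N p m) (hp : 1 ≤ p) (S : ℝ) :
    ∃ Λ : ℝ, 0 ≤ Λ ∧ ∀ (Ω : Set (E N)) (u : E N → ℝ), MemXZero V p Ω u →
      (∫ x, |u x| ^ p) ≤ S → (∫ x, ‖weakGrad u x‖ ^ p) ≤ S →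
        eLpNorm' u p volume ≤ ENNReal.ofReal Λ ∧ eLpNorm' u m volume ≤ ENNReal.ofReal Λ := by
  obtain ⟨C, hC⟩ := h
  have hp₀ : 0 < p := by linarith
  refine ⟨max 1 S * max 1 (2 * C), by positivity, fun Ω u hu hmass hgrad => ?_⟩
  have hroot {G : Type} [NormedAddCommGroup G] {w : E N → G}
      (hw : Integrable (fun x => ‖w x‖ ^ p) volume) (hS : ∫ x, ‖w x‖ ^ p ≤ S) :
      eLpNorm' w p volume ≤ ENNReal.ofReal (max 1 S) := by
    rw [← ENNReal.rpow_le_rpow_iff hp₀, eLpNorm'_rpow_eq_ofReal_integral hp₀ hw,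
      ENNReal.ofReal_rpow_of_nonneg (by positivity) hp₀.le]
    exact ENNReal.ofReal_le_ofReal ((hS.trans (le_max_right 1 S)).trans
      (Real.self_le_rpow_of_one_le (le_max_left _ _) hp))
  have hup := hroot (integrable_norm_rpow hp₀ hu.1.1.1) hmass
  refine ⟨hup.trans (ENNReal.ofReal_le_ofReal
    (le_mul_of_one_le_right (by positivity) (le_max_left _ _))), ?_⟩
  calc eLpNorm' u m volume
      ≤ C * (ENNReal.ofReal (max 1 S) + ENNReal.ofReal (max 1 S)) := by
        refine (hC Ω u hu.1).trans ?_
        gcongr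
        exact hroot (hu.integrable_norm_weakGrad_rpow hp₀) hgrad
    _ = ENNReal.ofReal (max 1 S * (2 * C)) := by
        rw [← ENNReal.ofReal_add (by positivity) (by positivity), ← ENNReal.ofReal_coe_nnreal,
          ← ENNReal.ofReal_mul C.coe_nonneg]
        ring_nf
    _ ≤ _ := by
        gcongr
        exact le_max_right _ _

lemma exists_forall_eLpNorm_top_le (hN : 2 ≤ N) (hp : 1 < p) (hV : AEMeasurable V volume)
    (hV₁ : HypV1 V) (hA₀ : IsCaratheodory 1 A) (hA₁ : HypH1 A) (hA₂ : HypH2 α₀ A)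
    (hA₄ : HypH4 p A) (hg₀ : IsCaratheodory 0 g) (hg₁ : HypG1 p q g)
    (hq : (q : EReal) < criticalExponent N p) (S : ℝ) :
    ∃ B : ℝ, ∀ (Ω : Set (E N)) (u : E N → ℝ), IsCriticalOn p A V g Ω u →
      (∫ x, |u x| ^ p) ≤ S → (∫ x, ‖weakGrad u x‖ ^ p) ≤ S →
        eLpNorm u ⊤ volume ≤ ENNReal.ofReal B := by
  obtain ⟨m, hqm, hm⟩ := exists_isSobolevExponent_gt hN hp hq
  obtain ⟨D, hD, hmoser⟩ := exists_forall_eLpNorm'_rpow_le hp hV hV₁ hA₀ hA₁ hA₂ hA₄ hg₀ hg₁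
    (by linarith [hg₁.1]) hm
  obtain ⟨Λ, hΛ, hΛu⟩ := hm.exists_eLpNorm'_le (V := V) hp.le S
  obtain ⟨B, hB⟩ := exists_eLpNorm_top_le_of_moser (α := E N) (ε := ℝ) (μ := volume)
    hp.le hg₁.1 hqm hD hΛ
  refine ⟨B, fun Ω u hu hmass hgrad => ?_⟩
  obtain ⟨hup, hum⟩ := hΛu Ω u hu.1 hmass hgrad
  exact hB u hu.1.1.1.1.1 hup hum (hmoser Ω u hu)

lemma rpow_one_div_le {a b r : ℝ} (ha : 0 ≤ a) (hab : a ≤ b) (hb : 1 ≤ b) (hr : 1 ≤ r) :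
    a ^ (1 / r) ≤ b :=
  calc a ^ (1 / r) ≤ b ^ (1 / r) := by gcongr
    _ ≤ b := Real.rpow_le_self_of_one_le hb (div_le_self zero_le_one hr)

lemma normV_le {S : ℝ} (hp : 1 ≤ p) (hV₁ : HypV1 V) (hS : 1 ≤ S)
    (hgrad : (∫ x, ‖weakGrad u x‖ ^ p) ≤ S) (hpot : (∫ x, V x * |u x| ^ p) ≤ S) :
    normV V p u ≤ 2 * S :=
  rpow_one_div_le
    (add_nonneg (integral_nonneg fun x => by positivity) (hV₁.integral_mul_abs_rpow_nonneg p))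
    (by linarith) (by linarith) hp

lemma MemXZero.memLV {r : ℝ} (hp : 0 < p) (hr : p ≤ r) (hu : MemXZero V p Ω u) :
    MemLV V r u := by
  have hr₀ : 0 < r := hp.trans_le hr
  refine ⟨?_, integrable_mul_abs_rpow hp hr hu.2.2 hu.2.1⟩
  rw [← integrable_norm_rpow_iff hu.1.1.1.1 (by simpa using hr₀) ENNReal.ofReal_ne_top,
    ENNReal.toReal_ofReal hr₀.le]
  exact hu.integrable_abs_rpow hp hr

lemma MemXZero.normLV_le {r b S : ℝ} (hp : 1 ≤ p) (hr : p ≤ r) (hV₁ : HypV1 V) (hb : 1 ≤ b)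
    (hS : 1 ≤ S) (hu : MemXZero V p Ω u) (hub : ∀ᵐ x, |u x| ≤ b)
    (hpot : (∫ x, V x * |u x| ^ p) ≤ S) : normLV V r u ≤ b * S := by
  have hp₀ : 0 < p := by linarith
  have hr₁ : 1 ≤ r := hp.trans hr
  have hle : ∫ x, V x * |u x| ^ r ≤ b ^ r * S := by
    calc ∫ x, V x * |u x| ^ r ≤ ∫ x, b ^ r * (V x * |u x| ^ p) := by
          refine integral_mono_ae (hu.memLV hp₀ hr).2 (hu.2.1.const_mul _) ?_
          filter_upwards [hub, hV₁.ae_nonneg] with x hx hVx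
          rw [← abs_rpow_sub_mul_rpow hp₀ hr, mul_left_comm]
          gcongr
          exact (Real.rpow_le_rpow (abs_nonneg _) hx (by linarith)).trans
            (Real.rpow_le_rpow_of_exponent_le hb (by linarith))
      _ ≤ b ^ r * S := by
          rw [integral_const_mul]
          gcongr
  calc normLV V r u ≤ (b ^ r * S) ^ (1 / r) := by
        rw [normLV]
        gcongr
        exact hV₁.integral_mul_abs_rpow_nonneg r
    _ = b * S ^ (1 / r) := by
        rw [Real.mul_rpow (by positivity) (by positivity), ← Real.rpow_mul (by positivity),
          mul_one_div_cancel (by positivity), Real.rpow_one]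
    _ ≤ b * S := by
        gcongr
        exact rpow_one_div_le (by positivity) le_rfl hS hr₁

end UniformBounds

end QuasilinearSchrodinger

open QuasilinearSchrodinger in
theorem proposition6p3_general {N : ℕ} (hN : 2 ≤ N) {p q μ α₀ : ℝ} (hp : 1 < p)
    {A : E N → ℝ → ℝ} {V : E N → ℝ} {g : E N → ℝ → ℝ} (hV : AEMeasurable V volume)
    (hV1 : HypV1 V) (hA0 : IsCaratheodory 1 A) (hA1 : HypH1 A) (hA2 : HypH2 α₀ A)
    (hA3 : HypH3 p μ A) (hA4 : HypH4 p A) (hg0 : IsCaratheodory 0 g) (hg1 : HypG1 p q g)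
    (hg3 : HypG3 μ g) (hq : (q : EReal) < criticalExponent N p) (c : ℝ) :
    ∃ M₀ : ℝ, 0 < M₀ ∧ ∀ (Ω : Set (E N)) (u : E N → ℝ), IsCriticalOn p A V g Ω u →
      J p A V g u ≤ c →
        (MemX V p u ∧ normX V p u ≤ M₀) ∧ ∀ r, p ≤ r → MemLV V r u ∧ normLV V r u ≤ M₀ := by
  obtain ⟨S, hS, henergy⟩ :=
    exists_forall_integral_le_of_J_le hp hV hV1 hA0 hA1 hA2 hA3 hg0 hg1 hg3 c
  obtain ⟨B, hB⟩ := exists_forall_eLpNorm_top_le hN hp hV hV1 hA0 hA1 hA2 hA4 hg0 hg1 hq S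
  set b := max 1 B
  have hb : 1 ≤ b := le_max_left _ _
  have hbS : b ≤ b * S := le_mul_of_one_le_right (by positivity) hS
  refine ⟨2 * S + b * S, by positivity, fun Ω u hu hJ => ?_⟩
  have hX := hu.1
  obtain ⟨hgrad, hpot, hmass⟩ := henergy Ω u hu hJ
  have hnorm : normLinf u ≤ b := ENNReal.toReal_le_of_le_ofReal (by positivity)
    ((hB Ω u hu hmass hgrad).trans (ENNReal.ofReal_le_ofReal (le_max_right _ _)))
  have hub : ∀ᵐ x, |u x| ≤ b := (ae_abs_le_eLpNorm_top hX.2.2).mono fun x hx => hx.trans hnorm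
  refine ⟨⟨⟨⟨hX.1.1, hX.2.1⟩, hX.2.2⟩, ?_⟩, fun r hr => ⟨hX.memLV (by linarith) hr, ?_⟩⟩
  · exact add_le_add (normV_le hp.le hV1 hS hgrad hpot) (hnorm.trans hbS)
  · exact (hX.normLV_le hp.le hr hV1 hb hS hub hpot).trans (by linarith)

open QuasilinearSchrodinger in
theorem proposition6p3 {N : ℕ} (hN : 2 ≤ N) (p q μ α₀ τ : ℝ) (hp : 1 < p)
    (A : E N → ℝ → ℝ) (V : E N → ℝ) (g : E N → ℝ → ℝ)
    (hV : AEMeasurable V MeasureTheory.volume)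
    (hV1 : HypV1 V) (hV2 : HypV2 V) (hV3 : HypV3 V)
    (hA0 : IsCaratheodory 1 A) (hA1 : HypH1 A) (hA2 : HypH2 α₀ A) (hA3 : HypH3 p μ A)
    (hA4 : HypH4 p A)
    (hg0 : IsCaratheodory 0 g) (hg1 : HypG1 p q g) (hτ : IsEmbeddingConst V p τ)
    (hg2 : HypG2 p α₀ τ g) (hg3 : HypG3 μ g)
    (hq : (q : EReal) < criticalExponent N p)
    (ϱ αlow αup : ℝ) (ustar : E N → ℝ)
    (hgeom : MountainPassGeometry p A V g ϱ αlow ustar)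
    (hαup : IsGreatest ((fun s : ℝ => J p A V g (fun x => s * ustar x)) '' Set.Icc 0 1) αup)
    (u : ℕ → E N → ℝ) (hu : IsMountainPassSequence p A V g αlow αup u) :
    ∃ M₀ : ℝ, 0 < M₀ ∧
      (∀ k : ℕ, 1 ≤ k → MemX V p (u k) ∧ normX V p (u k) ≤ M₀) ∧
      (∀ r : ℝ, p ≤ r → ∀ k : ℕ, 1 ≤ k →
        MemLV V r (u k) ∧ normLV V r (u k) ≤ M₀) := by
  obtain ⟨M₀, hM₀, hbound⟩ :=
    proposition6p3_general hN hp hV hV1 hA0 hA1 hA2 hA3 hA4 hg0 hg1 hg3 hq αup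
  have hk (k : ℕ) (hk : 1 ≤ k) :=
    hbound (Metric.ball 0 k) (u k) ⟨hu.mem k hk, hu.critical k hk⟩ (hu.level_le k hk)
  exact ⟨M₀, hM₀, fun k h => (hk k h).1, fun r hr k h => (hk k h).2 r hr⟩
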